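/- Let $c\ge 1$ be an integer. *Sequences.* Define $p_c(k)$ for $k\ge 1$ by $p_c(k)=1$ if $1\le k\le 2c$ and $p_c(k)=p_c(k-c-1)+p_c(k-c)$ if $k\ge 2c+1$, and let $m_c(n)=\min\{j\ge 1 : n<p_c(j)\}$ for $n\ge 1$. *Pawn race.* There are $n\ge 1$ pawns on the integers $1,2,\dots,n$. In every iteration each pawn either moves from its position $x$ to $x+1$, at cost $c+1$, or stays at $x$, at cost $c$; after every iteration, pawns in the same position merge into one pawn. A race is a sequence of iterations which merges all the pawns into one, and it is optimal if its total cost is minimal. Let $o_c(n)$ be the number of optimal races. *Automaton.* For $n\ge c+2$, let $C_n^c$ be the partial finite automaton with states $1,\dots,n$ and letters $a,b$, where $qa=q+1$ and $qb=q$ for $1\le q\le n-c-1$; $qa$ is undefined and $qb=q+1$ for $n-c\le q\le n-1$; and $na=nb=1$. A word $w$ is synchronizing if there is a state $s$ such that $qw$ is defined and $qw=s$ for every state $q$. **Theorem.** 1. $o_c(1)=o_c(2)=1$, and for every $n\ge 3$, with $k=m_c(n)-c-1$ and $$I_n=\{\,i : p_c(k-1)\le n-i\le p_c(k)\le i\le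 p_c(k+1)\,\},$$ one has $$o_c(n)=\sum_{i\in I_n}o_c(n-i)\,o_c(i).$$ 2. For every $n\ge 1$, $$o_c(n)=1\iff n=p_c(k')\text{ for some }k'\ge 1\iff n=p_c\big(m_c(n)-1\big).$$ 3. For every $n\ge c+2$, the shortest synchronizing word of $C_n^c$ is unique if and only if $n-c-1=p_c(k')$ for some $k'\ge 1$. -/

import Mathlib

/-! ### The pawn race -/

/-- One iteration of the pawn race on the integers.  `S` is the set of occupied positions and
`M ⊆ S` is the set of positions whose pawn moves from `x` to `x + 1`; the others stay.  Pawns that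
arrive at the same position merge. -/
def pawnStep (S M : Finset ℤ) : Finset ℤ :=
  (S \ M) ∪ M.image (fun x => x + 1)

/-- `IsPawnRace S r`: the list `r` of sets of moving pawns (one set for every iteration) is a legal
sequence of choices that merges the pawns at the positions `S` into a single pawn. -/
def IsPawnRace : Finset ℤ → List (Finset ℤ) → Prop
  | S, [] => S.card = 1
  | S, M :: r => M ⊆ S ∧ IsPawnRace (pawnStep S M) r

/-- The cost of a race starting from `S`: in every iteration, each moving pawn costs `c + 1` and
each staying pawn costs `c`. -/
def pawnRaceCost (c : ℕ) : Finset ℤ → List (Finset ℤ) → ℕ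
  | _, [] => 0
  | S, M :: r => (c + 1) * M.card + c * (S \ M).card + pawnRaceCost c (pawnStep S M) r

/-- An optimal solution of the pawn race with pawns on `1, 2, …, n`: a race of minimum cost. -/
def IsOptimalPawnRace (c n : ℕ) (r : List (Finset ℤ)) : Prop :=
  IsPawnRace (Finset.Icc 1 (n : ℤ)) r ∧
    ∀ s : List (Finset ℤ), IsPawnRace (Finset.Icc 1 (n : ℤ)) s →
      pawnRaceCost c (Finset.Icc 1 (n : ℤ)) r ≤ pawnRaceCost c (Finset.Icc 1 (n : ℤ)) s

/-- `o_c(n)`, the number of optimal solutions of the pawn race. -/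
noncomputable def numOptimalRaces (c n : ℕ) : ℕ :=
  {r : List (Finset ℤ) | IsOptimalPawnRace c n r}.ncard

/-! ### The sequence `p_c`, its twinverse `m_c`, and the index set `I_n` -/

/-- `p_c(k) = 1` for `1 ≤ k ≤ 2c` and `p_c(k) = p_c(k-c-1) + p_c(k-c)` for `k ≥ 2c+1`.
The sequence is used for `c ≥ 1` and `k ≥ 1` only; the values for `c = 0` or `k = 0` are
conventional. -/
def pSeq (c k : ℕ) : ℕ :=
  if c = 0 ∨ k ≤ 2 * c then 1 else pSeq c (k - c - 1) + pSeq c (k - c)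
termination_by k
decreasing_by all_goals omega

theorem pSeq_of_le {c k : ℕ} (hk : k ≤ 2 * c) : pSeq c k = 1 := by
  rw [pSeq, if_pos (Or.inr hk)]

theorem pSeq_of_lt {c k : ℕ} (hc : 1 ≤ c) (hk : 2 * c + 1 ≤ k) :
    pSeq c k = pSeq c (k - c - 1) + pSeq c (k - c) := by
  rw [pSeq, if_neg (by omega)]

/-- The twinverse of a sequence `p` indexed by the positive integers:
`m(i) = min {j ≥ 1 | i < p(j)}`. -/
noncomputable def twinverse (p : ℕ → ℕ) (i : ℕ) : ℕ :=
  sInf {j : ℕ | 1 ≤ j ∧ i < p j}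

/-- `m_c`, the twinverse of `p_c`. -/
noncomputable def mSeq (c n : ℕ) : ℕ := twinverse (pSeq c) n

/-- `I_n = {i | p_c(k-1) ≤ n-i ≤ p_c(k) ≤ i ≤ p_c(k+1)}`, where `k = m_c(n) - c - 1`.
For `c ≥ 1` and `n ≥ 3` one has `k ≥ 2c + 1`, and `i ≤ n` because `n - i` is at least
`p_c(k-1) ≥ 1`, so no subtraction is truncated. -/
noncomputable def indexSet (c n : ℕ) : Finset ℕ :=
  let k := mSeq c n - c - 1
  {i ∈ Finset.range (n + 1) |
    pSeq c (k - 1) ≤ n - i ∧ n - i ≤ pSeq c k ∧ pSeq c k ≤ i ∧ i ≤ pSeq c (k + 1)}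

/-! ### Partial finite automata and the Černý family -/

/-- A partial finite automaton with states in `σ` and alphabet `α`; `step q x = none` means that
`q x` is undefined. -/
structure PFA (α σ : Type) where
  states : Finset σ
  step : σ → α → Option σ
  step_mem : ∀ q ∈ states, ∀ x r, step q x = some r → r ∈ states

/-- The state `q w` (undefined as soon as one of the transitions is undefined). -/
def PFA.run {α σ : Type} (A : PFA α σ) (q : σ) (w : List α) : Option σ :=
  w.foldlM A.step q

/-- `w` is synchronizing: for some state `s`, `q w` is defined and equal to `s` for all states
`q`. -/
def PFA.IsSynchronizing {α σ : Type} (A : PFA α σ) (w : List α) : Prop :=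
  ∃ s ∈ A.states, ∀ q ∈ A.states, A.run q w = some s

/-- `w` is a shortest synchronizing word. -/
def PFA.IsShortestSynchronizing {α σ : Type} (A : PFA α σ) (w : List α) : Prop :=
  A.IsSynchronizing w ∧ ∀ v : List α, A.IsSynchronizing v → w.length ≤ v.length

/-- The binary alphabet `{a, b}`. -/
inductive Letter where
  | a
  | b

/-- The transition function of `C_n^c` on the states `1, …, n`. -/
def cernyStep (c n : ℕ) (q : ℕ) : Letter → Option ℕ
  | .a => if q ≤ n - c - 1 then some (q + 1) else if q ≤ n - 1 then none else some 1
  | .b => if q ≤ n - c - 1 then some q else if q ≤ n - 1 then some (q + 1) else some 1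

/-- The member `C_n^c` of the Černý family of binary PFAs (for `n ≥ c + 2`). -/
def cernyPFA (c n : ℕ) : PFA Letter ℕ where
  states := Finset.Icc 1 n
  step := cernyStep c n
  step_mem := by
    intro q hq x r h
    rw [Finset.mem_Icc] at hq ⊢
    cases x <;> simp only [cernyStep] at h <;> split_ifs at h <;> simp at h <;> omega

/-! Put `minCost c n` = m_c(1) + ... + m_c(n-1). At the last merge of a race a left group of a pawns
meets a right group of b = n - a pawns, each group having merged on its own. Compared with racing
separately, the left pawn makes b further moves and the waiting iterations cost c * n in total, so a
split costs `minCost c a + minCost c b + c * n + b`. As a function of a, this has increments m_c(a)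
- m_c(n-a-1) - 1, which are negative, zero and positive to the left of, inside and to the right of
the interval I_n (`splitCost_ge`). The recurrence of p_c links the boxes of optimal splits so that
the value on I_n is exactly `minCost c n` (`minCost_add`).

The lower bound is proved by induction over the last merge, for an abstract system of pawns with a
counter of iterations (`IsPawnSystem.groupBound_le`). In a race that attains it every slack
vanishes, so the race is the unique gluing of two optimal races; this bijection (`glueMap_bijOn`)
gives the recursion for o_c. Hence o_c(n) = 1 means that I_n is a singleton and both parts have a
unique race, which by induction singles out the terms of p_c.

For the automaton let N = n - c - 1. A shortest synchronizing word is b^(c+1) followed by a shortest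
word that synchronizes 1, ..., N, and the latter is a product of blocks a b^m. Seen from a frame
that rotates with a modulo N + 1, the states are pawns: passing the c + 1 upper states takes c
letters b to stay and c + 1 letters b to move, which are the costs of the race. The abstract bound
shows that at least `minCost c N` letters b are needed, and a speed bound that at least N(N-1)
letters a are needed (`blockWord_lower_bound`). Both are attained exactly by the words of optimal
races, and different races have different words (`isShortest_iff`, `raceWord_injOn`). -/

/-! ### The sequence p_c and its twinverse -/

theorem pSeq_pos (c k : ℕ) : 1 ≤ pSeq c k := by
  induction k using Nat.strong_induction_on with
  | _ k ih =>
    rw [pSeq]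
    split_ifs with h
    · exact le_rfl
    · have := ih (k - c) (by omega)
      omega

theorem pSeq_mono {c : ℕ} (hc : 1 ≤ c) : Monotone (pSeq c) := by
  refine monotone_nat_of_le_succ fun k => ?_
  induction k using Nat.strong_induction_on with
  | _ k ih =>
    by_cases h : k ≤ 2 * c
    · rw [pSeq_of_le h]
      exact pSeq_pos c _
    · rw [pSeq_of_lt hc (show 2 * c + 1 ≤ k by omega),
        pSeq_of_lt hc (show 2 * c + 1 ≤ k + 1 by omega)]
      have h1 := ih (k - c - 1) (by omega)
      have h2 := ih (k - c) (by omega)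
      rw [show k + 1 - c - 1 = k - c - 1 + 1 by omega, show k + 1 - c = k - c + 1 by omega]
      omega

theorem exists_lt_pSeq {c : ℕ} (hc : 1 ≤ c) (n : ℕ) : ∃ j, n < pSeq c j := by
  induction n with
  | zero => exact ⟨0, pSeq_pos c 0⟩
  | succ n ih =>
    obtain ⟨j, hj⟩ := ih
    refine ⟨j + 2 * c + 1, ?_⟩
    rw [pSeq_of_lt hc (by omega)]
    have h1 := pSeq_pos c (j + 2 * c + 1 - c - 1)
    have h2 : pSeq c j ≤ pSeq c (j + 2 * c + 1 - c) := pSeq_mono hc (by omega)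
    omega

/-- Monotonicity and unboundedness of p_c make m_c and p_c a Galois pair; later comparisons of
values of m_c go through this equivalence. -/
theorem mSeq_le_iff {c : ℕ} (hc : 1 ≤ c) {n j : ℕ} (hn : 1 ≤ n) :
    mSeq c n ≤ j ↔ n < pSeq c j := by
  have one_le : ∀ {j}, n < pSeq c j → 1 ≤ j := by
    intro j hj
    by_contra h
    rw [pSeq_of_le (show j ≤ 2 * c by omega)] at hj
    omega
  constructor
  · intro h
    have hne : {j : ℕ | 1 ≤ j ∧ n < pSeq c j}.Nonempty := by
      obtain ⟨j, hj⟩ := exists_lt_pSeq hc n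
      exact ⟨j, one_le hj, hj⟩
    exact lt_of_lt_of_le (Nat.sInf_mem hne).2 (pSeq_mono hc h)
  · intro h
    exact Nat.sInf_le ⟨one_le h, h⟩

theorem lt_mSeq_iff {c : ℕ} (hc : 1 ≤ c) {n k : ℕ} (hn : 1 ≤ n) :
    k < mSeq c n ↔ pSeq c k ≤ n := by
  rw [← not_le, mSeq_le_iff hc hn, not_lt]

theorem mSeq_eq_succ {c : ℕ} (hc : 1 ≤ c) {n k : ℕ} (h1 : pSeq c k ≤ n)
    (h2 : n < pSeq c (k + 1)) : mSeq c n = k + 1 := by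
  have hn : 1 ≤ n := (pSeq_pos c k).trans h1
  have := (lt_mSeq_iff hc hn).2 h1
  have := (mSeq_le_iff hc hn).2 h2
  omega

theorem two_mul_lt_mSeq {c : ℕ} (hc : 1 ≤ c) {n : ℕ} (hn : 1 ≤ n) : 2 * c < mSeq c n := by
  rw [lt_mSeq_iff hc hn, pSeq_of_le le_rfl]
  exact hn

theorem pSeq_pred_mSeq_le {c : ℕ} (hc : 1 ≤ c) {n : ℕ} (hn : 1 ≤ n) :
    pSeq c (mSeq c n - 1) ≤ n := by
  have := two_mul_lt_mSeq hc hn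
  rw [← lt_mSeq_iff hc hn]
  omega

theorem lt_pSeq_mSeq {c : ℕ} (hc : 1 ≤ c) {n : ℕ} (hn : 1 ≤ n) : n < pSeq c (mSeq c n) :=
  (mSeq_le_iff hc hn).1 le_rfl

theorem exists_eq_pSeq_iff {c : ℕ} (hc : 1 ≤ c) {n : ℕ} (hn : 1 ≤ n) :
    (∃ k, 1 ≤ k ∧ n = pSeq c k) ↔ n = pSeq c (mSeq c n - 1) := by
  have h2 := two_mul_lt_mSeq hc hn
  constructor
  · rintro ⟨k, -, hk⟩
    have h1 := (lt_mSeq_iff hc hn).2 hk.ge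
    have h3 : pSeq c k ≤ pSeq c (mSeq c n - 1) := pSeq_mono hc (by omega)
    have h4 := pSeq_pred_mSeq_le hc hn
    omega
  · intro h
    exact ⟨mSeq c n - 1, by omega, h⟩

/-! ### The cost recursion and its optimal splits -/

/-- The minimum cost of a pawn race with `n` pawns. -/
noncomputable def minCost (c n : ℕ) : ℕ := ∑ i ∈ Finset.Ico 1 n, mSeq c i

theorem minCost_one (c : ℕ) : minCost c 1 = 0 := by simp [minCost]

theorem minCost_succ (c : ℕ) {n : ℕ} (hn : 1 ≤ n) :
    minCost c (n + 1) = minCost c n + mSeq c n := by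
  rw [minCost, Finset.sum_Ico_succ_top hn, minCost]

theorem pSeq_add {c k : ℕ} (hc : 1 ≤ c) (hk : c + 1 ≤ k) :
    pSeq c (k + c) = pSeq c (k - 1) + pSeq c k := by
  rw [pSeq_of_lt hc (by omega)]
  congr 2 <;> omega

theorem pSeq_add_succ {c k : ℕ} (hc : 1 ≤ c) (hk : c + 1 ≤ k) :
    pSeq c (k + c + 1) = pSeq c k + pSeq c (k + 1) := by
  have := pSeq_add hc (show c + 1 ≤ k + 1 by omega)
  rwa [show k + 1 + c = k + c + 1 by omega, Nat.add_sub_cancel] at this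

/-- `IsOptSplit c k a b`: the pair `(a, b)` lies in the `k`-th box of optimal splits. -/
def IsOptSplit (c k a b : ℕ) : Prop :=
  pSeq c (k - 1) ≤ b ∧ b ≤ pSeq c k ∧ pSeq c k ≤ a ∧ a ≤ pSeq c (k + 1)

theorem mSeq_add_of_box {c k a b : ℕ} (hc : 1 ≤ c) (hk : c + 1 ≤ k)
    (h1 : pSeq c (k - 1) + pSeq c k ≤ a + b) (h2 : a + b < pSeq c k + pSeq c (k + 1)) :
    mSeq c (a + b) = k + c + 1 := by
  apply mSeq_eq_succ hc
  · rw [pSeq_add hc hk]; exact h1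
  · rw [pSeq_add_succ hc hk]; exact h2

/-- Inside the box m_c is constant on each side: m(a) = k + 1, m(b) = k and m(a+b) = k + c + 1.
Hence raising a, or b, by one adds k + c + 1 to both sides, and the identity spreads from the lower
corner to the whole box. -/
theorem minCost_add_step {c k : ℕ} (hc : 1 ≤ c) (hk : c + 1 ≤ k)
    (base : minCost c (pSeq c k + pSeq c (k - 1)) = minCost c (pSeq c k) +
      minCost c (pSeq c (k - 1)) + c * (pSeq c k + pSeq c (k - 1)) + pSeq c (k - 1)) :
    ∀ a b, IsOptSplit c k a b →
      minCost c (a + b) = minCost c a + minCost c b + c * (a + b) + b := by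
  have p1 := pSeq_pos c (k - 1)
  have p2 := pSeq_pos c k
  have left : ∀ a, pSeq c k ≤ a → a ≤ pSeq c (k + 1) →
      minCost c (a + pSeq c (k - 1)) = minCost c a +
      minCost c (pSeq c (k - 1)) + c * (a + pSeq c (k - 1)) + pSeq c (k - 1) := by
    intro a ha
    induction a, ha using Nat.le_induction with
    | base => intro _; exact base
    | succ a ha ih =>
      intro h
      have p3 : pSeq c (k - 1) ≤ pSeq c k := pSeq_mono hc (by omega)
      have e1 := mSeq_add_of_box hc hk (a := a) (b := pSeq c (k - 1)) (by omega) (by omega)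
      have e2 := mSeq_eq_succ hc ha (show a < pSeq c (k + 1) by omega)
      rw [show a + 1 + pSeq c (k - 1) = a + pSeq c (k - 1) + 1 by omega,
        minCost_succ c (by omega), minCost_succ c (by omega), ih (by omega), e1, e2]
      ring
  intro a b ⟨hb, hb', ha, ha'⟩
  induction b, hb using Nat.le_induction with
  | base => exact left a ha ha'
  | succ b hb ih =>
    have e1 := mSeq_add_of_box hc hk (a := a) (b := b) (by omega) (by omega)
    have e2 := mSeq_eq_succ hc hb (by rw [show k - 1 + 1 = k by omega]; omega)
    rw [← add_assoc, minCost_succ c (by omega), minCost_succ c (by omega), ih (by omega), e1, e2,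
      show k - 1 + 1 = k by omega]
    ring

/-- The lower corner of box k + 1 is the upper corner of box k, so the identity passes from box to
box. -/
theorem minCost_add {c k : ℕ} (hc : 1 ≤ c) (hk : c + 1 ≤ k) :
    ∀ a b, IsOptSplit c k a b →
      minCost c (a + b) = minCost c a + minCost c b + c * (a + b) + b := by
  induction k, hk using Nat.le_induction with
  | base =>
    apply minCost_add_step hc le_rfl
    -- For k = c + 1 the corner is (1, 1), because p_c equals 1 up to index 2c.
    have h1 : mSeq c 1 = 2 * c + 1 := by
      apply mSeq_eq_succ hc
      · rw [pSeq_of_le le_rfl]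
      · rw [pSeq_of_lt hc (by omega), pSeq_of_le (by omega), pSeq_of_le (by omega)]
        omega
    rw [pSeq_of_le (by omega), pSeq_of_le (by omega), minCost_succ c le_rfl, minCost_one, h1]
    ring
  | succ k hk ih =>
    apply minCost_add_step hc (by omega)
    have := ih (pSeq c (k + 1)) (pSeq c k) ⟨pSeq_mono hc (by omega), le_rfl,
      pSeq_mono hc (by omega), le_rfl⟩
    simpa using this

/-- The cost of the split of `n` pawns into `j` left pawns and `n - j` right ones. -/
noncomputable def splitCost (c n j : ℕ) : ℤ :=
  minCost c j + minCost c (n - j) + c * n + (n - j)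

theorem splitCost_succ (c : ℕ) {n j : ℕ} (hj : 1 ≤ j) (hn : j + 2 ≤ n) :
    splitCost c n (j + 1) = splitCost c n j + mSeq c j - mSeq c (n - j - 1) - 1 := by
  unfold splitCost
  have h := minCost_succ c (show 1 ≤ n - j - 1 by omega)
  rw [show n - j - 1 + 1 = n - j by omega] at h
  rw [minCost_succ c hj, h, show n - (j + 1) = n - j - 1 by omega]
  push_cast
  ring

theorem le_of_forall_le_succ_between {f : ℕ → ℤ} {a b : ℕ} (hab : a ≤ b)
    (h : ∀ j, a ≤ j → j < b → f j ≤ f (j + 1)) : f a ≤ f b := by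
  induction b, hab using Nat.le_induction with
  | base => exact le_rfl
  | succ b hb ih =>
    exact (ih fun j h1 h2 => h j h1 (by omega)).trans (h b hb (by omega))

/-- This is p_c(m-1) ≤ n < p_c(m) for m = m_c(n) = k + c + 1, with both ends expanded by the
recurrence. -/
theorem box_of_mSeq {c n k : ℕ} (hc : 1 ≤ c) (hn : 2 ≤ n) (hk : k = mSeq c n - c - 1) :
    c + 1 ≤ k ∧ pSeq c (k - 1) + pSeq c k ≤ n ∧ n < pSeq c k + pSeq c (k + 1) := by
  have h1 : 2 * c + 1 < mSeq c n := by
    rw [lt_mSeq_iff hc (by omega), pSeq_of_lt hc (by omega), pSeq_of_le (by omega),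
      pSeq_of_le (by omega)]
    exact hn
  have hk' : c + 1 ≤ k := by omega
  have e : mSeq c n = k + c + 1 := by omega
  have h2 := pSeq_pred_mSeq_le hc (show 1 ≤ n by omega)
  have h3 := lt_pSeq_mSeq hc (show 1 ≤ n by omega)
  rw [e, pSeq_add_succ hc hk'] at h3
  rw [e, Nat.add_sub_cancel, pSeq_add hc hk'] at h2
  exact ⟨hk', h2, h3⟩

theorem splitCost_eq {c n k j : ℕ} (hc : 1 ≤ c) (hk : c + 1 ≤ k) (hj : j ≤ n)
    (h : IsOptSplit c k j (n - j)) : splitCost c n j = minCost c n := by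
  have h1 := minCost_add hc hk j (n - j) h
  rw [Nat.add_sub_cancel' hj] at h1
  rw [h1, splitCost]
  push_cast [hj]
  ring

/-- A discrete convexity argument: the increments from `splitCost_succ` are strictly negative before
the box and strictly positive after it, so the minimum is attained on the box only. -/
theorem splitCost_ge {c n k j : ℕ} (hc : 1 ≤ c) (hn : 2 ≤ n) (hk : k = mSeq c n - c - 1)
    (hj : 1 ≤ j) (hjn : j < n) :
    (minCost c n : ℤ) ≤ splitCost c n j ∧
      (splitCost c n j = minCost c n → IsOptSplit c k j (n - j)) := by
  obtain ⟨hk', hlo, hhi⟩ := box_of_mSeq hc hn hk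
  have p1 := pSeq_pos c (k - 1)
  have p2 : pSeq c (k - 1) ≤ pSeq c k := pSeq_mono hc (by omega)
  have p3 : pSeq c k ≤ pSeq c (k + 1) := pSeq_mono hc (by omega)
  by_cases hbox : IsOptSplit c k j (n - j)
  · exact ⟨(splitCost_eq hc hk' hjn.le hbox).ge, fun _ => hbox⟩
  suffices h : (minCost c n : ℤ) < splitCost c n j from ⟨h.le, fun h' => absurd h' h.ne'⟩
  have small : ∀ {i q : ℕ}, 1 ≤ i → i < pSeq c q → mSeq c i ≤ q := fun h1 h2 =>
    (mSeq_le_iff hc h1).2 h2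
  have large : ∀ {i q : ℕ}, pSeq c q ≤ i → q + 1 ≤ mSeq c i := fun {i q} h =>
    (lt_mSeq_iff hc ((pSeq_pos c q).trans h)).2 h
  -- In terms of j, the box is the interval from max(p_k, n - p_k) to min(p_{k+1}, n - p_{k-1}).
  by_cases hside : j < max (pSeq c k) (n - pSeq c k)
  · -- the box lies to the right of `j`
    set J := max (pSeq c k) (n - pSeq c k) with hJ
    have hJbox : IsOptSplit c k J (n - J) := by unfold IsOptSplit; omega
    have step : ∀ i, 1 ≤ i → i < J → splitCost c n (i + 1) < splitCost c n i := by
      intro i hi hiJ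
      rw [splitCost_succ c hi (by omega)]
      have : mSeq c i ≤ mSeq c (n - i - 1) := by
        rcases lt_or_ge i (pSeq c k) with h | h
        · have a1 := small hi h
          have a2 := large (i := n - i - 1) (q := k - 1) (by omega)
          omega
        · have a1 := small (q := k + 1) hi (by omega)
          have a2 := large (i := n - i - 1) (q := k) (by omega)
          omega
      omega
    have h1 := step j hj hside
    have h2 : -splitCost c n (j + 1) ≤ -splitCost c n J :=
      le_of_forall_le_succ_between (f := fun i => -splitCost c n i) (by omega)
        fun i h3 h4 => neg_le_neg (step i (by omega) h4).le
    have h3 := splitCost_eq hc hk' (by omega) hJbox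
    omega
  · set J := min (pSeq c (k + 1)) (n - pSeq c (k - 1)) with hJ
    have hJbox : IsOptSplit c k J (n - J) := by unfold IsOptSplit; omega
    have hJj : J < j := by
      by_contra hcon
      apply hbox
      unfold IsOptSplit
      omega
    have step : ∀ i, J ≤ i → i < j → splitCost c n i < splitCost c n (i + 1) := by
      intro i hi hij
      rw [splitCost_succ c (by omega) (by omega)]
      have : mSeq c (n - i - 1) + 2 ≤ mSeq c i := by
        rcases le_or_gt (pSeq c (k + 1)) i with h | h
        · have a1 := large h
          have a2 := small (i := n - i - 1) (q := k) (by omega) (by omega)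
          omega
        · have a1 := large (i := i) (q := k) (by omega)
          have a2 := small (i := n - i - 1) (q := k - 1) (by omega) (by omega)
          omega
      omega
    have h1 := step (j - 1) (by omega) (by omega)
    rw [show j - 1 + 1 = j by omega] at h1
    have h2 := le_of_forall_le_succ_between (f := splitCost c n) (show J ≤ j - 1 by omega)
      fun i h3 h4 => (step i h3 (by omega)).le
    have h3 := splitCost_eq hc hk' (by omega) hJbox
    omega

theorem minCost_add_le {c a b : ℕ} (hc : 1 ≤ c) (ha : 1 ≤ a) (hb : 1 ≤ b) :
    minCost c (a + b) ≤ minCost c a + minCost c b + c * (a + b) + b := by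
  have h := (splitCost_ge hc (n := a + b) (j := a) (by omega) rfl ha (by omega)).1
  rw [splitCost, Nat.add_sub_cancel_left] at h
  zify
  push_cast at h
  linarith

/-- From here on I_n is used only as the set of minimizers of the split cost. -/
theorem mem_indexSet_iff {c n j : ℕ} (hc : 1 ≤ c) (hn : 2 ≤ n) :
    j ∈ indexSet c n ↔ 1 ≤ j ∧ j < n ∧
      minCost c n = minCost c j + minCost c (n - j) + c * n + (n - j) := by
  obtain ⟨hk, -, -⟩ := box_of_mSeq hc hn rfl
  have h1 : j ∈ indexSet c n ↔ j ≤ n ∧ IsOptSplit c (mSeq c n - c - 1) j (n - j) := by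
    simp [indexSet, IsOptSplit]
  have p1 := pSeq_pos c (mSeq c n - c - 1 - 1)
  have p2 := pSeq_pos c (mSeq c n - c - 1)
  have key : ∀ h : j ≤ n, splitCost c n j = minCost c n ↔
      minCost c n = minCost c j + minCost c (n - j) + c * n + (n - j) := by
    intro h
    zify [h]
    rw [splitCost]
    exact eq_comm
  rw [h1]
  constructor
  · rintro ⟨h2, h3⟩
    refine ⟨by unfold IsOptSplit at h3; omega, by unfold IsOptSplit at h3; omega, ?_⟩
    exact (key h2).1 (splitCost_eq hc hk h2 h3)
  · rintro ⟨h2, h3, h4⟩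
    exact ⟨h3.le, (splitCost_ge hc hn rfl h2 h3).2 ((key h3.le).2 h4)⟩

theorem indexSet_nonempty {c n : ℕ} (hc : 1 ≤ c) (hn : 2 ≤ n) : (indexSet c n).Nonempty := by
  obtain ⟨hk, hlo, hhi⟩ := box_of_mSeq hc hn rfl
  set k := mSeq c n - c - 1 with hk0
  have p2 : pSeq c (k - 1) ≤ pSeq c k := pSeq_mono hc (by omega)
  have p3 : pSeq c k ≤ pSeq c (k + 1) := pSeq_mono hc (by omega)
  refine ⟨max (pSeq c k) (n - pSeq c k), ?_⟩
  simp only [indexSet, Finset.mem_filter, Finset.mem_range, ← hk0]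
  omega

/-! ### The lower bound for abstract pawn systems -/

section PawnSystem

variable {c : ℕ} {F V : ℕ → ℤ → ℤ}

/-- The position at time `t` of the pawn that starts at `y`, when a pawn at position `x` at
time `t` moves to `F t x`. -/
def traj (F : ℕ → ℤ → ℤ) : ℕ → ℤ → ℤ
  | 0, y => y
  | t + 1, y => F t (traj F t y)

/-- The cost of a step of the pawn at `y` at time `t`, where `V t y` is the number of iterations
that a pawn at `y` has gone through at time `t`. -/
def stepCost (c : ℕ) (F V : ℕ → ℤ → ℤ) (t : ℕ) (y : ℤ) : ℤ :=
  c * (V (t + 1) (F t y) - V t y) + (F t y - y)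

/-- The cost up to time `t` of the pawns which start at the positions `P`. -/
def groupCost (c : ℕ) (F V : ℕ → ℤ → ℤ) (P : Finset ℤ) (t : ℕ) : ℤ :=
  ∑ s ∈ Finset.range t, ∑ y ∈ P.image (traj F s), stepCost c F V s y

/-- Every pawn stays or moves one step at any time, and it can only move by an iteration. -/
structure IsPawnSystem (F V : ℕ → ℤ → ℤ) : Prop where
  step : ∀ t y, F t y = y ∨ F t y = y + 1
  visit : ∀ t y, V t y + (F t y - y) ≤ V (t + 1) (F t y)
  mono : Monotone (V 0)

/-- The distances between the starting positions `P` are large enough. -/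
def IsSpread (V : ℕ → ℤ → ℤ) (P : Finset ℤ) : Prop :=
  ∀ u ∈ P, ∀ v ∈ P, u ≤ v →
    ((P.filter fun p => u ≤ p ∧ p ≤ v).card : ℤ) - 1 + (V 0 v - V 0 u) ≤ v - u

theorem IsSpread.subset {V : ℕ → ℤ → ℤ} {P Q : Finset ℤ} (h : IsSpread V P) (hQ : Q ⊆ P) :
    IsSpread V Q := by
  intro u hu v hv huv
  have h1 := h u (hQ hu) v (hQ hv) huv
  have h2 := Finset.card_le_card
    (Finset.filter_subset_filter (fun p => u ≤ p ∧ p ≤ v) hQ)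
  omega

theorem IsPawnSystem.monotone (h : IsPawnSystem F V) (t : ℕ) : Monotone (F t) := by
  intro x y hxy
  rcases hxy.eq_or_lt with rfl | hlt
  · exact le_rfl
  · have := h.step t x
    have := h.step t y
    omega

theorem IsPawnSystem.traj_mono (h : IsPawnSystem F V) (t : ℕ) : Monotone (traj F t) := by
  induction t with
  | zero => exact fun x y hxy => hxy
  | succ t ih => exact fun x y hxy => h.monotone t (ih hxy)

theorem traj_eq_of_le {x y : ℤ} {s t : ℕ} (hst : s ≤ t) (h : traj F s x = traj F s y) :
    traj F t x = traj F t y := by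
  induction t, hst using Nat.le_induction with
  | base => exact h
  | succ t _ ih => simp only [traj, ih]

theorem IsPawnSystem.traj_le_traj (h : IsPawnSystem F V) (y : ℤ) {s t : ℕ} (hst : s ≤ t) :
    traj F s y ≤ traj F t y := by
  induction t, hst using Nat.le_induction with
  | base => exact le_rfl
  | succ t _ ih =>
    have := h.step t (traj F t y)
    simp only [traj]
    omega

theorem IsPawnSystem.traj_le_add (h : IsPawnSystem F V) (y : ℤ) {s t : ℕ} (hst : s ≤ t) :
    traj F t y ≤ traj F s y + (t - s) := by
  induction t, hst using Nat.le_induction with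
  | base => simp
  | succ t _ ih =>
    have := h.step t (traj F t y)
    simp only [traj]
    push_cast
    omega

theorem IsPawnSystem.visit_traj (h : IsPawnSystem F V) (y : ℤ) (t : ℕ) :
    V 0 y + (traj F t y - y) ≤ V t (traj F t y) := by
  induction t with
  | zero => simp [traj]
  | succ t ih =>
    have := h.visit t (traj F t y)
    simp only [traj]
    omega

theorem groupCost_succ (P : Finset ℤ) (t : ℕ) :
    groupCost c F V P (t + 1) =
      groupCost c F V P t + ∑ y ∈ P.image (traj F t), stepCost c F V t y :=
  Finset.sum_range_succ _ _

/-- A merged group pays as one pawn, and its step costs telescope. -/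
theorem groupCost_of_merged {P : Finset ℤ} (hP : P.Nonempty) {s t : ℕ} (hst : s ≤ t) {x z : ℤ}
    (hx : ∀ p ∈ P, traj F s p = x) (hz : ∀ p ∈ P, traj F t p = z) :
    groupCost c F V P t = groupCost c F V P s + c * (V t z - V s x) + (z - x) := by
  induction t, hst using Nat.le_induction generalizing z with
  | base =>
    obtain ⟨p, hp⟩ := hP
    rw [← hx p hp, ← hz p hp]
    ring
  | succ t hst ih =>
    obtain ⟨p, hp⟩ := id hP
    have h1 : ∀ q ∈ P, traj F t q = traj F t p := fun q hq =>
      traj_eq_of_le hst ((hx q hq).trans (hx p hp).symm)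
    have h2 : P.image (traj F t) = {traj F t p} := by
      ext y
      simp only [Finset.mem_image, Finset.mem_singleton]
      exact ⟨fun ⟨q, hq, e⟩ => e ▸ h1 q hq, fun e => ⟨p, hp, e.symm⟩⟩
    rw [groupCost_succ, ih h1, h2, Finset.sum_singleton, stepCost, ← hz p hp]
    simp only [traj]
    ring

/-- The step made at time t is charged by position at time t. So costs are still additive at t + 1,
even if the two groups merge in that very step. -/
theorem groupCost_union {A B : Finset ℤ} {t : ℕ}
    (h : ∀ a ∈ A, ∀ b ∈ B, traj F t a ≠ traj F t b) :
    groupCost c F V (A ∪ B) t = groupCost c F V A t + groupCost c F V B t ∧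
    groupCost c F V (A ∪ B) (t + 1) = groupCost c F V A (t + 1) + groupCost c F V B (t + 1) := by
  have key : ∀ s ≤ t, ∑ y ∈ (A ∪ B).image (traj F s), stepCost c F V s y =
      ∑ y ∈ A.image (traj F s), stepCost c F V s y +
      ∑ y ∈ B.image (traj F s), stepCost c F V s y := by
    intro s hs
    rw [Finset.image_union, Finset.sum_union]
    rw [Finset.disjoint_left]
    simp only [Finset.mem_image]
    rintro _ ⟨a, ha, rfl⟩ ⟨b, hb, hab⟩
    exact h a ha b hb (traj_eq_of_le hs hab.symm)
  have h1 : groupCost c F V (A ∪ B) t = groupCost c F V A t + groupCost c F V B t := by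
    unfold groupCost
    rw [← Finset.sum_add_distrib]
    exact Finset.sum_congr rfl fun s hs => key s (Finset.mem_range.1 hs).le
  refine ⟨h1, ?_⟩
  rw [groupCost_succ, groupCost_succ, groupCost_succ, h1, key t le_rfl]
  ring

/-- The last merge of a group of pawns. -/
theorem IsPawnSystem.exists_last_merge (h : IsPawnSystem F V) {P : Finset ℤ} (hP : 2 ≤ P.card)
    {t : ℕ} {z : ℤ} (hz : ∀ p ∈ P, traj F t p = z) :
    ∃ s x, ∃ A B : Finset ℤ, s < t ∧ A.Nonempty ∧ B.Nonempty ∧ A ∪ B = P ∧ Disjoint A B ∧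
      (∀ a ∈ A, ∀ b ∈ B, a < b) ∧ (∀ a ∈ A, traj F s a = x) ∧ (∀ b ∈ B, traj F s b = x + 1) ∧
      (∀ p ∈ P, traj F (s + 1) p = x + 1) ∧
      groupCost c F V P t = groupCost c F V A s + groupCost c F V B s +
        c * (V (s + 1) (x + 1) - V s x - V s (x + 1)) + 1 + c * V t z + (z - (x + 1)) := by
  classical
  have hP0 : P.Nonempty := Finset.card_pos.1 (by omega)
  have hex : ∃ s, ∀ p ∈ P, ∀ q ∈ P, traj F s p = traj F s q :=
    ⟨t, fun p hp q hq => (hz p hp).trans (hz q hq).symm⟩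
  -- The first time at which all of P has merged; it is s + 1 for the required s.
  obtain ⟨s', hs', hmin⟩ : ∃ s', (∀ p ∈ P, ∀ q ∈ P, traj F s' p = traj F s' q) ∧
      ∀ r < s', ¬ ∀ p ∈ P, ∀ q ∈ P, traj F r p = traj F r q :=
    ⟨Nat.find hex, Nat.find_spec hex, fun r hr => Nat.find_min hex hr⟩
  have hs0 : s' ≠ 0 := by
    rintro rfl
    obtain ⟨p, hp, q, hq, hpq⟩ := Finset.one_lt_card.1 (show 1 < P.card by omega)
    exact hpq (hs' p hp q hq)
  obtain ⟨s, rfl⟩ := Nat.exists_eq_succ_of_ne_zero hs0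
  have hst : s + 1 ≤ t := by
    by_contra hcon
    exact hmin t (by omega) fun p hp q hq => (hz p hp).trans (hz q hq).symm
  set u := P.min' hP0 with hu
  have huP : u ∈ P := P.min'_mem hP0
  set v := P.max' hP0 with hv
  have hvP : v ∈ P := P.max'_mem hP0
  have hbetween : ∀ p ∈ P, traj F s u ≤ traj F s p ∧ traj F s p ≤ traj F s v := fun p hp =>
    ⟨h.traj_mono s (P.min'_le p hp), h.traj_mono s (P.le_max' p hp)⟩
  have hne : traj F s u ≠ traj F s v := by
    intro e
    apply hmin s (by omega)
    intro p hp q hq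
    have := hbetween p hp
    have := hbetween q hq
    omega
  have hlt : traj F s u < traj F s v := lt_of_le_of_ne (hbetween v hvP).1 hne
  have hm := hs' u huP v hvP
  simp only [traj] at hm
  have hu1 := h.step s (traj F s u)
  have hv1 := h.step s (traj F s v)
  set x := traj F s u with hx
  -- The extreme pawns differ at time s and agree one step later, and each moves by 0 or 1. So their
  -- distance is one, the left one moves and the right one stays.
  have hvx : traj F s v = x + 1 := by omega
  have hFx : F s x = x + 1 := by omega
  have hFx1 : F s (x + 1) = x + 1 := by rw [hvx] at hv1 hm; omega
  refine ⟨s, x, P.filter (fun p => traj F s p = x), P.filter (fun p => ¬ traj F s p = x), hst,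
    ⟨u, by simp [huP, hx]⟩, ⟨v, by simp [hvP, hvx]⟩, Finset.filter_union_filter_not_eq _ _,
    Finset.disjoint_filter_filter_not _ _ _, ?_, ?_, ?_, ?_, ?_⟩
  · intro a ha b hb
    rw [Finset.mem_filter] at ha hb
    by_contra hcon
    have h1 := h.traj_mono s (not_lt.1 hcon)
    have h2 := hbetween b hb.1
    exact hb.2 (by omega)
  · exact fun a ha => (Finset.mem_filter.1 ha).2
  · intro b hb
    rw [Finset.mem_filter] at hb
    have := hbetween b hb.1
    omega
  · intro p hp
    rw [hs' p hp u huP]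
    simp only [traj, ← hx, hFx]
  · have hA : ∀ a ∈ P.filter (fun p => traj F s p = x), traj F s a = x :=
      fun a ha => (Finset.mem_filter.1 ha).2
    have hB : ∀ b ∈ P.filter (fun p => ¬ traj F s p = x), traj F s b = x + 1 := by
      intro b hb
      rw [Finset.mem_filter] at hb
      have := hbetween b hb.1
      omega
    have hall : ∀ p ∈ P, traj F (s + 1) p = x + 1 := by
      intro p hp
      rw [hs' p hp u huP]
      simp only [traj, ← hx, hFx]
    have e1 := groupCost_of_merged (c := c) (V := V) hP0 hst hall hz
    have e2 := (groupCost_union (c := c) (F := F) (V := V) (t := s)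
      (A := P.filter (fun p => traj F s p = x)) (B := P.filter (fun p => ¬ traj F s p = x))
      (fun a ha b hb => by rw [hA a ha, hB b hb]; omega)).2
    have e3 := groupCost_of_merged (c := c) (V := V)
      (P := P.filter (fun p => traj F s p = x)) ⟨u, by simp [huP, hx]⟩ (Nat.le_succ s) hA
      (fun a ha => hall a (Finset.mem_filter.1 ha).1)
    have e4 := groupCost_of_merged (c := c) (V := V)
      (P := P.filter (fun p => ¬ traj F s p = x)) ⟨v, by simp [hvP, hvx]⟩ (Nat.le_succ s) hB
      (fun a ha => hall a (Finset.mem_filter.1 ha).1)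
    rw [Finset.filter_union_filter_not_eq] at e2
    simp only [Nat.succ_eq_add_one] at *
    linarith

/-- The lower bound for the cost of the pawns `P`, the last of which starts at `v`, when they have
merged at `z` at time `t`. -/
noncomputable def groupBound (c : ℕ) (V : ℕ → ℤ → ℤ) (P : Finset ℤ) (v : ℤ) (t : ℕ) (z : ℤ) : ℤ :=
  minCost c P.card + c * (V t z - V 0 v - (P.card - 1)) + (z - v)

/-- The excess of the cost over `groupBound` is the excess of both parts plus three terms: the
defect of the split in the recursion for `minCost`, the superfluous visits and the superfluous
moves. Keeping this as an equality serves both the lower bound and the analysis of equality. -/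
theorem IsPawnSystem.exists_split (h : IsPawnSystem F V) {P : Finset ℤ} (hP : 2 ≤ P.card)
    (hPs : IsSpread V P) {t : ℕ} {z v : ℤ} (hz : ∀ p ∈ P, traj F t p = z) (hv : v ∈ P)
    (hvP : ∀ p ∈ P, p ≤ v) :
    ∃ s x a, ∃ A B : Finset ℤ, s < t ∧ A ∪ B = P ∧ Disjoint A B ∧
      (∀ a ∈ A, ∀ b ∈ B, a < b) ∧ a ∈ A ∧ (∀ p ∈ A, p ≤ a) ∧ v ∈ B ∧
      (∀ a ∈ A, traj F s a = x) ∧ (∀ b ∈ B, traj F s b = x + 1) ∧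
      (∀ p ∈ P, traj F (s + 1) p = x + 1) ∧
      (P.card : ℤ) - 1 ≤ V (s + 1) (x + 1) - V 0 a ∧ (B.card : ℤ) ≤ x + 1 - a ∧
      groupCost c F V P t - groupBound c V P v t z =
        (groupCost c F V A s - groupBound c V A a s x) +
        (groupCost c F V B s - groupBound c V B v s (x + 1)) +
        (minCost c A.card + minCost c B.card + c * (A.card + B.card) + B.card -
          minCost c P.card) +
        c * (V (s + 1) (x + 1) - V 0 a - (P.card - 1)) + (x + 1 - a - B.card) := by
  obtain ⟨s, x, A, B, hst, hA, hB, hAB, hdisj, hlt, hAx, hBx, hx, hcost⟩ :=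
    h.exists_last_merge (c := c) hP hz
  have hvB : v ∈ B := by
    obtain ⟨b, hb⟩ := hB
    rw [← hAB, Finset.mem_union] at hv
    refine hv.resolve_left fun hvA => ?_
    have h1 := hlt v hvA b hb
    have h2 := hvP b (hAB ▸ Finset.mem_union_right _ hb)
    omega
  have haA := A.max'_mem hA
  have hmax := A.le_max'
  set a := A.max' hA
  have hP0 : P.Nonempty := ⟨v, hv⟩
  have huP := P.min'_mem hP0
  have humin := P.min'_le
  set u := P.min' hP0
  have hcard : P.card = A.card + B.card := by
    rw [← hAB, Finset.card_union_of_disjoint hdisj]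
  have hav := hlt a haA v hvB
  have haP : a ∈ P := hAB ▸ Finset.mem_union_left _ haA
  have hV0 := h.mono hav.le
  have hxv : v ≤ x + 1 := by
    rw [← hx v hv]
    exact h.traj_le_traj v (Nat.zero_le _)
  have h1 : (B.card : ℤ) ≤ x + 1 - a := by
    have e1 := hPs a haP v hv hav.le
    -- The pawns of P from a to v include a and all of B, so the spread condition gives |B| ≤ v - a;
    -- here V 0 is monotone.
    have e2 : (insert a B).card ≤ (P.filter fun p => a ≤ p ∧ p ≤ v).card := by
      apply Finset.card_le_card
      intro p hp
      rw [Finset.mem_filter]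
      rcases Finset.mem_insert.1 hp with rfl | hp
      · exact ⟨haP, le_rfl, hav.le⟩
      · have hpP : p ∈ P := hAB ▸ Finset.mem_union_right _ hp
        exact ⟨hpP, (hlt a haA p hp).le, hvP p hpP⟩
    rw [Finset.card_insert_of_notMem (Finset.disjoint_left.1 hdisj haA)] at e2
    omega
  -- The leftmost pawn u travels at least to v, with one visit per move, and the spread condition
  -- turns the distance v - u into |P| - 1 + V 0 v - V 0 u.
  have h2 : (P.card : ℤ) - 1 ≤ V (s + 1) (x + 1) - V 0 a := by
    have e1 := hPs u huP v hv (humin v hv)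
    rw [Finset.filter_true_of_mem fun p hp => ⟨humin p hp, hvP p hp⟩] at e1
    have e2 := h.visit_traj u (s + 1)
    rw [hx u huP] at e2
    omega
  refine ⟨s, x, a, A, B, hst, hAB, hdisj, hlt, haA, hmax, hvB, hAx, hBx, hx, h2, h1, ?_⟩
  rw [hcost]
  unfold groupBound
  rw [hcard]
  push_cast
  ring

/-- Induction on the number of pawns: each summand of the excess in `exists_split` is nonnegative,
by induction, by `minCost_add_le` or by the stated inequalities. -/
theorem IsPawnSystem.groupBound_le (h : IsPawnSystem F V) (hc : 1 ≤ c) {P : Finset ℤ}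
    (hPs : IsSpread V P) {t : ℕ} {z v : ℤ} (hz : ∀ p ∈ P, traj F t p = z) (hv : v ∈ P)
    (hvP : ∀ p ∈ P, p ≤ v) : groupBound c V P v t z ≤ groupCost c F V P t := by
  induction hn : P.card using Nat.strong_induction_on generalizing P t z v with
  | _ n ih =>
    rcases lt_or_ge n 2 with h1 | h2
    · have hcard : P.card = 1 := by
        have := Finset.card_pos.2 ⟨v, hv⟩
        omega
      have e := groupCost_of_merged (c := c) (F := F) (V := V) ⟨v, hv⟩ (Nat.zero_le t) (x := v)
        (fun p hp => Finset.card_le_one.1 hcard.le _ hp _ hv) hz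
      rw [e, groupBound, hcard, minCost_one]
      simp [groupCost]
    · obtain ⟨s, x, a, A, B, -, hAB, hdisj, -, haA, hmax, hvB, hAx, hBx, -, h3, h4, heq⟩ :=
        h.exists_split (c := c) (by omega) hPs hz hv hvP
      have hA : A ⊆ P := hAB ▸ Finset.subset_union_left
      have hB : B ⊆ P := hAB ▸ Finset.subset_union_right
      have hcard : P.card = A.card + B.card := by
        rw [← hAB, Finset.card_union_of_disjoint hdisj]
      have hA1 := Finset.card_pos.2 ⟨a, haA⟩
      have hB1 := Finset.card_pos.2 ⟨v, hvB⟩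
      have iA := ih A.card (by omega) (hPs.subset hA) hAx haA hmax rfl
      have iB := ih B.card (by omega) (hPs.subset hB) hBx hvB (fun p hp => hvP p (hB hp)) rfl
      have e := minCost_add_le hc hA1 hB1
      rw [← hcard] at e
      have e' : (minCost c P.card : ℤ) ≤ minCost c A.card + minCost c B.card +
        c * (A.card + B.card) + B.card := by rw [hcard] at e ⊢; exact_mod_cast e
      have e2 : 0 ≤ (c : ℤ) * (V (s + 1) (x + 1) - V 0 a - (P.card - 1)) :=
        mul_nonneg (by positivity) (by linarith)
      linarith

end PawnSystem

/-! ### Races that attain the lower bound -/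

section TightRace

variable {c : ℕ} {F V : ℕ → ℤ → ℤ}

/-- The new position of a pawn at `y`, when `M t` is the set of the moving pawns at time `t`. -/
def raceMove (M : ℕ → Finset ℤ) (t : ℕ) (y : ℤ) : ℤ := if y ∈ M t then y + 1 else y

/-- In a pawn race, all pawns take part in every iteration. -/
def raceVisits (t : ℕ) (_ : ℤ) : ℤ := t

theorem raceMove_of_mem {M : ℕ → Finset ℤ} {t : ℕ} {y : ℤ} (h : y ∈ M t) :
    raceMove M t y = y + 1 := if_pos h

theorem raceMove_of_notMem {M : ℕ → Finset ℤ} {t : ℕ} {y : ℤ} (h : y ∉ M t) :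
    raceMove M t y = y := if_neg h

theorem raceMove_congr {M M' : ℕ → Finset ℤ} {t : ℕ} {y : ℤ} (h : y ∈ M t ↔ y ∈ M' t) :
    raceMove M t y = raceMove M' t y := by
  simp only [raceMove, h]

theorem isPawnSystem_race (M : ℕ → Finset ℤ) : IsPawnSystem (raceMove M) raceVisits where
  step t y := by unfold raceMove; split_ifs <;> simp
  visit t y := by unfold raceMove raceVisits; split_ifs <;> push_cast <;> omega
  mono _ _ _ := le_rfl

theorem isSpread_race (P : Finset ℤ) : IsSpread raceVisits P := by
  intro u _ v _ huv
  have h : (P.filter fun p => u ≤ p ∧ p ≤ v).card ≤ (Finset.Icc u v).card := by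
    apply Finset.card_le_card
    intro p hp
    exact Finset.mem_Icc.2 (Finset.mem_filter.1 hp).2
  rw [Int.card_Icc] at h
  simp only [raceVisits]
  omega

theorem traj_congr {F' : ℕ → ℤ → ℤ} {p : ℤ} {T : ℕ}
    (h : ∀ t < T, F t (traj F t p) = F' t (traj F t p)) {t : ℕ} (ht : t ≤ T) :
    traj F' t p = traj F t p := by
  induction t with
  | zero => rfl
  | succ t ih => simp only [traj]; rw [ih (by omega), h t ht]

theorem groupCost_congr {F' : ℕ → ℤ → ℤ} {P : Finset ℤ} {T : ℕ}
    (h : ∀ p ∈ P, ∀ t < T, F t (traj F t p) = F' t (traj F t p)) :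
    groupCost c F' V P T = groupCost c F V P T := by
  refine Finset.sum_congr rfl fun t ht => ?_
  have ht := Finset.mem_range.1 ht
  have e : P.image (traj F' t) = P.image (traj F t) :=
    Finset.image_congr fun p hp => traj_congr (h p hp) ht.le
  rw [e]
  refine Finset.sum_congr rfl fun y hy => ?_
  obtain ⟨p, hp, rfl⟩ := Finset.mem_image.1 hy
  simp only [stepCost, h p hp t ht]

/-- The starting positions of `n` adjacent pawns after position `s`. -/
noncomputable abbrev block (s : ℤ) (n : ℕ) : Finset ℤ := Finset.Icc (s + 1) (s + n)

theorem card_block (s : ℤ) (n : ℕ) : (block s n).card = n := by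
  rw [Int.card_Icc]
  omega

/-- The rightmost pawn never goes back, and the leftmost one gains at most one position per
iteration. -/
theorem time_of_merged {M : ℕ → Finset ℤ} {s z : ℤ} {n t : ℕ} (hn : 1 ≤ n)
    (hz : ∀ p ∈ block s n, traj (raceMove M) t p = z) : n - 1 ≤ t ∧ s + n ≤ z := by
  have h1 := (isPawnSystem_race M).traj_le_add (s + 1) (Nat.zero_le t)
  have h2 := (isPawnSystem_race M).traj_le_traj (s + n) (Nat.zero_le t)
  rw [hz _ (Finset.mem_Icc.2 (by omega))] at h1
  rw [hz _ (Finset.mem_Icc.2 (by omega))] at h2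
  simp only [traj] at h1 h2
  omega

theorem groupBound_block (s z : ℤ) (n t : ℕ) :
    groupBound c raceVisits (block s n) (s + n) t z =
      minCost c n + c * (t - (n - 1)) + (z - (s + n)) := by
  simp [groupBound, raceVisits]

theorem raceCost_ge (hc : 1 ≤ c) {M : ℕ → Finset ℤ} {s z : ℤ} {n t : ℕ} (hn : 1 ≤ n)
    (hz : ∀ p ∈ block s n, traj (raceMove M) t p = z) :
    minCost c n + c * (t - (n - 1)) + (z - (s + n)) ≤
      groupCost c (raceMove M) raceVisits (block s n) t := by
  rw [← groupBound_block]
  exact (isPawnSystem_race M).groupBound_le hc (isSpread_race _) hz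
    (Finset.mem_Icc.2 (by omega)) fun p hp => (Finset.mem_Icc.1 hp).2

/-- A race is tight if its cost attains the lower bound. -/
def IsTight (c : ℕ) (M : ℕ → Finset ℤ) (s : ℤ) (n t : ℕ) (z : ℤ) : Prop :=
  (∀ p ∈ block s n, traj (raceMove M) t p = z) ∧
    groupCost c (raceMove M) raceVisits (block s n) t =
      minCost c n + c * (t - (n - 1)) + (z - (s + n))

/-- The total excess is zero, so each summand in the decomposition at the last merge is zero. This
fixes the time n - 2 and the positions s + n - 1 and s + n just before the merge, and makes both
parts tight. -/
theorem IsTight.exists_split (hc : 1 ≤ c) {M : ℕ → Finset ℤ} {s z : ℤ} {n t : ℕ} (hn : 2 ≤ n)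
    (h : IsTight c M s n t z) :
    ∃ a b, 1 ≤ a ∧ 1 ≤ b ∧ a + b = n ∧
      minCost c n = minCost c a + minCost c b + c * n + b ∧
      IsTight c M s a (n - 2) (s + n - 1) ∧ IsTight c M (s + a) b (n - 2) (s + n) ∧
      (∀ p ∈ block s n, traj (raceMove M) (n - 1) p = s + n) := by
  obtain ⟨r, x, m, A, B, hst, hAB, hdisj, hlt, haA, hmax, hvB, hAx, hBx, hx, h3, h4, heq⟩ :=
    (isPawnSystem_race M).exists_split (c := c) (by rw [card_block]; exact hn) (isSpread_race _)
      h.1 (Finset.mem_Icc.2 (by omega : s + 1 ≤ s + n ∧ s + n ≤ s + n))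
      fun p hp => (Finset.mem_Icc.1 hp).2
  have hA : A ⊆ block s n := hAB ▸ Finset.subset_union_left
  have hB : B ⊆ block s n := hAB ▸ Finset.subset_union_right
  have hm := Finset.mem_Icc.1 (hA haA)
  have hmv := hlt m haA _ hvB
  obtain ⟨a, ha⟩ : ∃ a : ℕ, m = s + a := ⟨(m - s).toNat, by omega⟩
  obtain ⟨b, hb⟩ : ∃ b : ℕ, n = a + b := ⟨n - a, by omega⟩
  have hmemAB : ∀ p ∈ block s n, p ∈ A ∨ p ∈ B := fun p hp => by
    rwa [← hAB, Finset.mem_union] at hp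
  have eA : A = block s a := by
    ext p
    rw [Finset.mem_Icc]
    constructor
    · intro hp
      have := Finset.mem_Icc.1 (hA hp)
      have := hmax p hp
      omega
    · intro hp
      refine (hmemAB p (Finset.mem_Icc.2 (by omega))).resolve_right fun hpB => ?_
      have := hlt m haA p hpB
      omega
  have eB : B = block (s + a) b := by
    ext p
    rw [Finset.mem_Icc]
    constructor
    · intro hp
      have := Finset.mem_Icc.1 (hB hp)
      have := hlt m haA p hp
      omega
    · intro hp
      refine (hmemAB p (Finset.mem_Icc.2 (by omega))).resolve_left fun hpA => ?_
      have := hmax p hpA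
      omega
  have hsn : s + (n : ℤ) = s + a + b := by omega
  subst ha eA eB
  have g1 := (isPawnSystem_race M).groupBound_le hc (isSpread_race _) hAx haA hmax
  have g2 := (isPawnSystem_race M).groupBound_le hc (isSpread_race _) hBx hvB
    fun p hp => (Finset.mem_Icc.1 hp).2.trans hsn.ge
  have ht := groupBound_block (c := c) s z n t
  have ht' := groupBound_block (c := c) (s + a) (x + 1) b r
  have htA := groupBound_block (c := c) s x a r
  have hle := minCost_add_le hc (show 1 ≤ a by omega) (show 1 ≤ b by omega)
  rw [hsn] at heq g2
  rw [hsn] at ht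
  simp only [card_block, raceVisits] at heq h3 h4
  zify at hle
  rw [← hb] at hle
  have hle' : (minCost c n : ℤ) ≤ minCost c a + minCost c b + c * (a + b) + b := by
    rw [hb]; rw [hb] at hle; linarith
  have e0 : 0 ≤ (c : ℤ) * ((r + 1 : ℕ) - (0 : ℕ) - (n - 1)) :=
    mul_nonneg (by positivity) (by linarith)
  have hcost := h.2
  -- The summands of the excess are nonnegative with sum zero. As c ≠ 0, the merge happens at time n
  -- - 1.
  have hz1 : (c : ℤ) * ((r + 1 : ℕ) - (0 : ℕ) - (n - 1)) = 0 := by linarith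
  have hr : r = n - 2 := by
    rcases mul_eq_zero.1 hz1 with h | h <;> omega
  have hx1 : x + 1 = s + n := by linarith
  refine ⟨a, b, by omega, by omega, hb.symm, ?_, ⟨?_, ?_⟩, ⟨?_, ?_⟩, ?_⟩
  · zify
    rw [show (n : ℤ) = a + b by omega]
    linarith
  · rw [← hr]; intro p hp; rw [hAx p hp]; omega
  · rw [← hr, show s + n - 1 = x by omega]
    linarith
  · rw [← hr]; intro p hp; rw [hBx p hp]; omega
  · rw [← hr, ← hx1]
    linarith
  · intro p hp
    rw [show n - 1 = r + 1 by omega, hx p hp, hx1]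

/-- By the split, a tight group has already merged at s + n after n - 1 iterations; what it pays
later is the cost of a single pawn and can be removed. -/
theorem IsTight.reduce (hc : 1 ≤ c) {M : ℕ → Finset ℤ} {s z : ℤ} {n t : ℕ} (hn : 1 ≤ n)
    (h : IsTight c M s n t z) : IsTight c M s n (n - 1) (s + n) := by
  have h1 : ∀ p ∈ block s n, traj (raceMove M) (n - 1) p = s + n := by
    rcases hn.eq_or_lt with rfl | hn
    · intro p hp
      rw [Finset.mem_Icc] at hp
      change p = _
      omega
    · obtain ⟨a, b, -, -, -, -, -, -, h2⟩ := h.exists_split hc hn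
      exact h2
  refine ⟨h1, ?_⟩
  have ht := (time_of_merged hn h.1).1
  have h2 := groupCost_of_merged (c := c) (V := raceVisits)
    ⟨s + n, Finset.mem_Icc.2 (by omega)⟩ ht h1 h.1
  rw [h.2] at h2
  simp only [raceVisits] at h2
  push_cast [hn] at h2 ⊢
  linarith

end TightRace

/-! ### Gluing and splitting optimal races -/

section OptimalRace

variable {c : ℕ}

/-- The optimal pawn races with `n` pawns after position `s`. -/
def optRaces (c : ℕ) (s : ℤ) (n : ℕ) : Set (ℕ → Finset ℤ) :=
  {M | (∀ t < n - 1, M t ⊆ (block s n).image (traj (raceMove M) t)) ∧ (∀ t, n - 1 ≤ t → M t = ∅) ∧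
    IsTight c M s n (n - 1) (s + n)}

theorem optRaces_pos {M : ℕ → Finset ℤ} {s : ℤ} {n : ℕ} (h : M ∈ optRaces c s n) {p : ℤ}
    (hp : p ∈ block s n) {t : ℕ} (ht : t ≤ n - 1) :
    s + t + 1 ≤ traj (raceMove M) t p ∧ traj (raceMove M) t p ≤ s + n := by
  have h1 := (isPawnSystem_race M).traj_le_add p ht
  have h2 := (isPawnSystem_race M).traj_le_traj p ht
  rw [h.2.2.1 p hp] at h1 h2
  rw [Finset.mem_Icc] at hp
  omega

theorem optRaces_mem {M : ℕ → Finset ℤ} {s : ℤ} {n : ℕ} (h : M ∈ optRaces c s n) {t : ℕ} {y : ℤ}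
    (hy : y ∈ M t) : t < n - 1 ∧ s + t + 1 ≤ y ∧ y ≤ s + n := by
  rcases lt_or_ge t (n - 1) with ht | ht
  · obtain ⟨p, hp, rfl⟩ := Finset.mem_image.1 (h.1 t ht hy)
    exact ⟨ht, optRaces_pos h hp ht.le⟩
  · rw [h.2.1 t ht] at hy
    simp at hy

/-- The moves of the pawns starting at `P` before time `T`. -/
def restrictMoves (P : Finset ℤ) (M : ℕ → Finset ℤ) (T t : ℕ) : Finset ℤ :=
  if t < T then M t ∩ P.image (traj (raceMove M) t) else ∅

/-- The race in which `a` left pawns race by `A`, the other pawns race by `B`, and when the left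
pawns have merged, the resulting pawn moves until the end. -/
def glueMoves (s : ℤ) (a n : ℕ) (A B : ℕ → Finset ℤ) (t : ℕ) : Finset ℤ :=
  (if t < a - 1 then A t else if t < n - 1 then {s + t + 1} else ∅) ∪ B t

section Glue

variable {s : ℤ} {a b n : ℕ} {A B : ℕ → Finset ℤ}

/-- The races do not interfere: at time t the left race lives on positions at most s + a, and the
right race moves only pawns at or beyond s + a + t + 1. After its merge the left pawn moves in every
iteration up to time n - 1. -/
theorem traj_glue_left (ha : 1 ≤ a) (hA : A ∈ optRaces c s a)
    (hB : B ∈ optRaces c (s + a) b) {p : ℤ} (hp : p ∈ block s a) :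
    (∀ t < a - 1, raceMove A t (traj (raceMove A) t p) =
      raceMove (glueMoves s a n A B) t (traj (raceMove A) t p)) ∧
    ∀ t, a - 1 ≤ t → t ≤ n - 1 → traj (raceMove (glueMoves s a n A B)) t p = s + t + 1 := by
  have h1 : ∀ t < a - 1, raceMove A t (traj (raceMove A) t p) =
      raceMove (glueMoves s a n A B) t (traj (raceMove A) t p) := by
    intro t ht
    apply raceMove_congr
    have h2 := optRaces_pos hA hp ht.le
    have h3 : traj (raceMove A) t p ∉ B t := fun h => by
      have := optRaces_mem hB h
      omega
    simp [glueMoves, ht, h3]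
  refine ⟨h1, fun t hat htn => ?_⟩
  induction t, hat using Nat.le_induction with
  | base =>
    rw [traj_congr h1 le_rfl, hA.2.2.1 p hp]
    push_cast [ha]
    ring
  | succ t hat ih =>
    simp only [traj]
    rw [ih (by omega), raceMove_of_mem]
    · push_cast; ring
    · simp [glueMoves, hat.not_gt, show t < n - 1 by omega]

theorem traj_glue_right (ha : 1 ≤ a) (hb : 1 ≤ b) (hab : a + b = n) (hA : A ∈ optRaces c s a)
    (hB : B ∈ optRaces c (s + a) b) {p : ℤ} (hp : p ∈ block (s + a) b) :
    (∀ t < b - 1, raceMove B t (traj (raceMove B) t p) =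
      raceMove (glueMoves s a n A B) t (traj (raceMove B) t p)) ∧
    ∀ t, b - 1 ≤ t → t ≤ n - 1 → traj (raceMove (glueMoves s a n A B)) t p = s + n := by
  have h1 : ∀ t < b - 1, raceMove B t (traj (raceMove B) t p) =
      raceMove (glueMoves s a n A B) t (traj (raceMove B) t p) := by
    intro t ht
    apply raceMove_congr
    have h2 := optRaces_pos hB hp ht.le
    have h3 : traj (raceMove B) t p ∉ A t := fun h => by
      have := optRaces_mem hA h
      omega
    have h4 : traj (raceMove B) t p ≠ s + t + 1 := by omega
    unfold glueMoves
    split_ifs <;> simp [h3, h4]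
  refine ⟨h1, fun t hat htn => ?_⟩
  induction t, hat using Nat.le_induction with
  | base =>
    rw [traj_congr h1 le_rfl, hB.2.2.1 p hp]
    push_cast [← hab]
    ring
  | succ t hat ih =>
    simp only [traj]
    rw [ih (by omega), raceMove_of_notMem]
    have h3 : s + (n : ℤ) ∉ A t := fun h => by
      have := optRaces_mem hA h
      omega
    have h4 : s + (n : ℤ) ≠ s + t + 1 := by omega
    unfold glueMoves
    rw [hB.2.1 t hat]
    split_ifs <;> simp [h3, h4]

theorem block_union (hab : a + b = n) : block s a ∪ block (s + a) b = block s n := by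
  ext p
  simp only [Finset.mem_union, Finset.mem_Icc]
  omega

theorem image_glue_left (ha : 1 ≤ a) (hA : A ∈ optRaces c s a) (hB : B ∈ optRaces c (s + a) b)
    {t : ℕ} (ht : t ≤ a - 1) :
    (block s a).image (traj (raceMove (glueMoves s a n A B)) t) =
      (block s a).image (traj (raceMove A) t) :=
  Finset.image_congr fun _ hp => traj_congr (traj_glue_left (n := n) ha hA hB hp).1 ht

theorem image_glue_right (ha : 1 ≤ a) (hb : 1 ≤ b) (hab : a + b = n) (hA : A ∈ optRaces c s a)
    (hB : B ∈ optRaces c (s + a) b) {t : ℕ} (ht : t ≤ b - 1) :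
    (block (s + a) b).image (traj (raceMove (glueMoves s a n A B)) t) =
      (block (s + a) b).image (traj (raceMove B) t) :=
  Finset.image_congr fun _ hp => traj_congr (traj_glue_right ha hb hab hA hB hp).1 ht

theorem groupCost_glue (ha : 1 ≤ a) (hb : 1 ≤ b) (hab : a + b = n) (hA : A ∈ optRaces c s a)
    (hB : B ∈ optRaces c (s + a) b) :
    groupCost c (raceMove (glueMoves s a n A B)) raceVisits (block s n) (n - 1) =
      minCost c a + minCost c b + c * n + b := by
  -- At time r = n - 2 the groups stand at s + n - 1 and s + n and are still apart, so their costs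
  -- add up through the final iteration.
  obtain ⟨r, hr⟩ : ∃ r, n = r + 2 := ⟨n - 2, by omega⟩
  have hL := fun p hp => traj_glue_left (n := n) (p := p) ha hA hB hp
  have hR := fun p hp => traj_glue_right (p := p) ha hb hab hA hB hp
  have e1 := (groupCost_union (c := c) (F := raceMove (glueMoves s a n A B)) (V := raceVisits)
    (A := block s a) (B := block (s + a) b) (t := r) (fun p hp q hq => by
      rw [(hL p hp).2 r (by omega) (by omega), (hR q hq).2 r (by omega) (by omega)]
      omega)).2
  have eA := groupCost_of_merged (c := c) (V := raceVisits) (P := block s a)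
    (F := raceMove (glueMoves s a n A B)) ⟨s + a, Finset.mem_Icc.2 (by omega)⟩
    (show a - 1 ≤ r + 1 by omega) (fun p hp => (hL p hp).2 (a - 1) le_rfl (by omega))
    (fun p hp => (hL p hp).2 (r + 1) (by omega) (by omega))
  have eB := groupCost_of_merged (c := c) (V := raceVisits) (P := block (s + a) b)
    (F := raceMove (glueMoves s a n A B)) ⟨s + n, Finset.mem_Icc.2 (by omega)⟩
    (show b - 1 ≤ r + 1 by omega) (fun p hp => (hR p hp).2 (b - 1) le_rfl (by omega))
    (fun p hp => (hR p hp).2 (r + 1) (by omega) (by omega))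
  rw [groupCost_congr (F := raceMove A) (fun p hp => (hL p hp).1), hA.2.2.2] at eA
  rw [groupCost_congr (F := raceMove B) (fun p hp => (hR p hp).1), hB.2.2.2] at eB
  rw [block_union hab, show r + 1 = n - 1 by omega] at e1
  rw [show r + 1 = n - 1 by omega] at eA eB
  rw [e1, eA, eB]
  simp only [raceVisits]
  rw [← hab]
  push_cast [ha, hb, show 1 ≤ a + b by omega]
  ring

theorem glue_mem_optRaces (ha : 1 ≤ a) (hb : 1 ≤ b) (hab : a + b = n)
    (hmin : minCost c n = minCost c a + minCost c b + c * n + b) (hA : A ∈ optRaces c s a)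
    (hB : B ∈ optRaces c (s + a) b) : glueMoves s a n A B ∈ optRaces c s n := by
  have hL := fun p hp => traj_glue_left (n := n) (p := p) ha hA hB hp
  have hR := fun p hp => traj_glue_right (p := p) ha hb hab hA hB hp
  refine ⟨fun t ht => ?_, fun t ht => ?_, fun p hp => ?_, ?_⟩
  · rw [← block_union hab, Finset.image_union]
    apply Finset.union_subset_union
    · split_ifs with h1
      · rw [image_glue_left ha hA hB h1.le]
        exact hA.1 t h1
      · rw [Finset.singleton_subset_iff, Finset.mem_image]
        exact ⟨s + a, Finset.mem_Icc.2 (by omega),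
          (hL _ (Finset.mem_Icc.2 (by omega))).2 t (by omega) (by omega)⟩
    · rcases lt_or_ge t (b - 1) with h1 | h1
      · rw [image_glue_right ha hb hab hA hB h1.le]
        exact hB.1 t h1
      · rw [hB.2.1 t h1]
        exact Finset.empty_subset _
  · unfold glueMoves
    rw [hB.2.1 t (by omega), if_neg (by omega), if_neg (by omega), Finset.union_empty]
  · rw [← block_union hab, Finset.mem_union] at hp
    rcases hp with hp | hp
    · rw [(hL p hp).2 (n - 1) (by omega) le_rfl]
      push_cast [show 1 ≤ n by omega]
      ring
    · exact (hR p hp).2 (n - 1) (by omega) le_rfl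
  · rw [groupCost_glue ha hb hab hA hB, hmin]
    push_cast [show 1 ≤ n by omega]
    ring

theorem restrict_glue_left (ha : 1 ≤ a) (hA : A ∈ optRaces c s a)
    (hB : B ∈ optRaces c (s + a) b) :
    restrictMoves (block s a) (glueMoves s a n A B) (a - 1) = A := by
  funext t
  unfold restrictMoves
  split_ifs with ht
  · rw [image_glue_left ha hA hB ht.le]
    ext y
    simp only [glueMoves, if_pos ht, Finset.mem_inter, Finset.mem_union]
    constructor
    · rintro ⟨h1 | h1, h2⟩
      · exact h1
      · obtain ⟨p, hp, rfl⟩ := Finset.mem_image.1 h2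
        have := optRaces_mem hB h1
        have := optRaces_pos hA hp ht.le
        omega
    · exact fun h => ⟨Or.inl h, hA.1 t ht h⟩
  · exact (hA.2.1 t (by omega)).symm

theorem restrict_glue_right (ha : 1 ≤ a) (hb : 1 ≤ b) (hab : a + b = n) (hA : A ∈ optRaces c s a)
    (hB : B ∈ optRaces c (s + a) b) :
    restrictMoves (block (s + a) b) (glueMoves s a n A B) (b - 1) = B := by
  funext t
  unfold restrictMoves
  split_ifs with ht
  · rw [image_glue_right ha hb hab hA hB ht.le]
    ext y
    simp only [glueMoves, Finset.mem_inter, Finset.mem_union]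
    constructor
    · rintro ⟨h1 | h1, h2⟩
      · obtain ⟨p, hp, rfl⟩ := Finset.mem_image.1 h2
        have h3 := optRaces_pos hB hp ht.le
        split_ifs at h1 with h4 h5
        · have := optRaces_mem hA h1
          omega
        · rw [Finset.mem_singleton] at h1
          omega
        · simp at h1
      · exact h1
    · exact fun h => ⟨Or.inr h, hB.1 t ht h⟩
  · exact (hB.2.1 t (by omega)).symm

/-- One iteration before the end only the left group is still at s + n - 1, so the glued race
determines a. -/
theorem glue_split_index {p : ℤ} (ha : 1 ≤ a) (hb : 1 ≤ b) (hab : a + b = n)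
    (hA : A ∈ optRaces c s a) (hB : B ∈ optRaces c (s + a) b) (hp : p ∈ block s n) :
    traj (raceMove (glueMoves s a n A B)) (n - 2) p = s + n - 1 ↔ p ≤ s + a := by
  rw [← block_union hab, Finset.mem_union] at hp
  rcases hp with hp | hp
  · rw [(traj_glue_left (n := n) ha hA hB hp).2 (n - 2) (by omega) (by omega)]
    rw [Finset.mem_Icc] at hp
    omega
  · rw [(traj_glue_right ha hb hab hA hB hp).2 (n - 2) (by omega) (by omega)]
    rw [Finset.mem_Icc] at hp
    omega

end Glue

theorem traj_restrict {P : Finset ℤ} {M : ℕ → Finset ℤ} {T : ℕ} {p : ℤ} (hp : p ∈ P) :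
    ∀ t < T, raceMove M t (traj (raceMove M) t p) =
      raceMove (restrictMoves P M T) t (traj (raceMove M) t p) := by
  intro t ht
  apply raceMove_congr
  simp only [restrictMoves, if_pos ht, Finset.mem_inter]
  exact ⟨fun h => ⟨h, Finset.mem_image_of_mem _ hp⟩, fun h => h.1⟩

theorem IsTight.restrict_mem_optRaces {M : ℕ → Finset ℤ} {s : ℤ} {n : ℕ}
    (h : IsTight c M s n (n - 1) (s + n)) :
    restrictMoves (block s n) M (n - 1) ∈ optRaces c s n := by
  have e : ∀ t ≤ n - 1, ∀ p ∈ block s n,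
      traj (raceMove (restrictMoves (block s n) M (n - 1))) t p = traj (raceMove M) t p :=
    fun t ht p hp => traj_congr (traj_restrict hp) ht
  refine ⟨fun t ht => ?_, fun t ht => ?_, fun p hp => ?_, ?_⟩
  · rw [Finset.image_congr (e t ht.le), restrictMoves, if_pos ht]
    exact Finset.inter_subset_right
  · rw [restrictMoves, if_neg (by omega)]
  · rw [e _ le_rfl p hp, h.1 p hp]
  · rw [groupCost_congr (F := raceMove M) (fun p hp => traj_restrict hp), h.2]

/-- An optimal race splits into two optimal races. -/
theorem optRaces_split (hc : 1 ≤ c) {M : ℕ → Finset ℤ} {s : ℤ} {n : ℕ} (hn : 2 ≤ n)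
    (hM : M ∈ optRaces c s n) :
    ∃ a b, 1 ≤ a ∧ 1 ≤ b ∧ a + b = n ∧
      minCost c n = minCost c a + minCost c b + c * n + b ∧
      restrictMoves (block s a) M (a - 1) ∈ optRaces c s a ∧
      restrictMoves (block (s + a) b) M (b - 1) ∈ optRaces c (s + a) b ∧
      glueMoves s a n (restrictMoves (block s a) M (a - 1))
        (restrictMoves (block (s + a) b) M (b - 1)) = M := by
  obtain ⟨a, b, ha, hb, hab, hmin, htA, htB, -⟩ := hM.2.2.exists_split hc hn
  have hsys := isPawnSystem_race M
  have rA := htA.reduce hc ha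
  have rB := htB.reduce hc hb
  refine ⟨a, b, ha, hb, hab, hmin, rA.restrict_mem_optRaces, rB.restrict_mem_optRaces, ?_⟩
  have hsub : ∀ {p}, p ∈ block s a ∨ p ∈ block (s + a) b → p ∈ block s n := fun h => by
    rwa [← block_union hab, Finset.mem_union]
  -- The left group is at s + a at time a - 1 and at s + n - 1 at time n - 2, so it moves in every
  -- iteration between.
  have posA : ∀ p ∈ block s a, ∀ t, a - 1 ≤ t → t ≤ n - 1 →
      traj (raceMove M) t p = s + t + 1 := by
    intro p hp t h1 h2
    have e1 := hsys.traj_le_add p h1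
    have e2 := hsys.traj_le_add p h2
    rw [rA.1 p hp] at e1
    rw [hM.2.2.1 p (hsub (Or.inl hp))] at e2
    rcases h2.eq_or_lt with rfl | h2
    · rw [hM.2.2.1 p (hsub (Or.inl hp))]
      omega
    · have e3 := hsys.traj_le_add p (show t ≤ n - 2 by omega)
      rw [htA.1 p hp] at e3
      omega
  -- The right group already stands at its final position s + n at time b - 1.
  have posB : ∀ p ∈ block (s + a) b, ∀ t, b - 1 ≤ t → t ≤ n - 1 →
      traj (raceMove M) t p = s + n := by
    intro p hp t h1 h2
    have e1 := hsys.traj_le_traj p h1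
    have e2 := hsys.traj_le_traj p h2
    rw [rB.1 p hp] at e1
    rw [hM.2.2.1 p (hsub (Or.inr hp))] at e2
    omega
  have hsA : s + a ∈ block s a := Finset.mem_Icc.2 (by omega)
  have hsB : s + a + b ∈ block (s + a) b := Finset.mem_Icc.2 (by omega)
  funext t
  rcases lt_or_ge t (n - 1) with ht | ht
  · have key : M t = M t ∩ (block s a).image (traj (raceMove M) t) ∪
        M t ∩ (block (s + a) b).image (traj (raceMove M) t) := by
      rw [← Finset.inter_union_distrib_left, ← Finset.image_union, block_union hab]
      exact (Finset.inter_eq_left.2 (hM.1 t ht)).symm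
    rw [key]
    unfold glueMoves
    congr 1
    · unfold restrictMoves
      by_cases h1 : t < a - 1
      · rw [if_pos h1, if_pos h1]
      · rw [if_neg h1, if_pos ht]
        have e1 := posA _ hsA t (by omega) ht.le
        have e2 := posA _ hsA (t + 1) (by omega) (by omega)
        simp only [traj] at e2
        rw [e1] at e2
        ext y
        simp only [Finset.mem_singleton, Finset.mem_inter, Finset.mem_image]
        constructor
        · rintro rfl
          refine ⟨?_, _, hsA, e1⟩
          by_contra hcon
          rw [raceMove_of_notMem hcon] at e2
          push_cast at e2
          omega
        · rintro ⟨-, p, hp, rfl⟩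
          exact posA p hp t (by omega) ht.le
    · unfold restrictMoves
      by_cases h1 : t < b - 1
      · rw [if_pos h1]
      · rw [if_neg h1]
        ext y
        simp only [Finset.notMem_empty, Finset.mem_inter, Finset.mem_image, false_iff]
        rintro ⟨hy, p, hp, rfl⟩
        have e1 := posB p hp t (by omega) ht.le
        have e2 := posB p hp (t + 1) (by omega) (by omega)
        simp only [traj] at e2
        rw [raceMove_of_mem hy, e1] at e2
        omega
  · unfold glueMoves restrictMoves
    rw [hM.2.1 t ht, if_neg (by omega), if_neg (by omega), if_neg (by omega), Finset.union_empty]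

theorem optRaces_one (c : ℕ) (s : ℤ) : optRaces c s 1 = {fun _ => ∅} := by
  ext M
  rw [Set.mem_singleton_iff]
  constructor
  · intro h
    funext t
    exact h.2.1 t (by omega)
  · rintro rfl
    refine ⟨fun t _ => Finset.empty_subset _, fun _ _ => rfl, fun p hp => ?_, ?_⟩
    · rw [Finset.mem_Icc] at hp
      change p = _
      omega
    · simp [groupCost, minCost_one]

/-- The gluing of optimal races. -/
noncomputable def glueMap (c : ℕ) (s : ℤ) (n : ℕ)
    (x : Σ a : {a // a ∈ indexSet c n},
      optRaces c s a × optRaces c (s + (a : ℕ)) (n - a)) : ℕ → Finset ℤ :=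
  glueMoves s x.1 n x.2.1 x.2.2

theorem mem_indexSet_iff' (hc : 1 ≤ c) {n a b : ℕ} (hab : a + b = n) (ha : 1 ≤ a) (hb : 1 ≤ b) :
    a ∈ indexSet c n ↔ minCost c n = minCost c a + minCost c b + c * n + b := by
  rw [mem_indexSet_iff hc (by omega), show n - a = b by omega]
  exact ⟨fun h => h.2.2, fun h => ⟨ha, by omega, h⟩⟩

/-- The split index is recovered from the positions at time n - 2 and the two races by restriction;
surjectivity is the splitting of an optimal race. -/
theorem glueMap_bijOn (hc : 1 ≤ c) (s : ℤ) {n : ℕ} (hn : 2 ≤ n) :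
    Set.BijOn (glueMap c s n) Set.univ (optRaces c s n) := by
  refine ⟨?_, ?_, ?_⟩
  · rintro ⟨⟨a, ha⟩, ⟨A, hA⟩, ⟨B, hB⟩⟩ -
    obtain ⟨h1, h2, h3⟩ := (mem_indexSet_iff hc hn).1 ha
    exact glue_mem_optRaces h1 (show 1 ≤ n - a by omega) (show a + (n - a) = n by omega)
      h3 hA hB
  · rintro ⟨⟨a, ha⟩, ⟨A, hA⟩, ⟨B, hB⟩⟩ - ⟨⟨a', ha'⟩, ⟨A', hA'⟩, ⟨B', hB'⟩⟩ - h
    obtain ⟨h1, h2, h3⟩ := (mem_indexSet_iff hc hn).1 ha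
    obtain ⟨h1', h2', h3'⟩ := (mem_indexSet_iff hc hn).1 ha'
    dsimp only at hA hB hA' hB'
    change glueMoves s a n A B = glueMoves s a' n A' B' at h
    have key : ∀ p ∈ block s n, p ≤ s + a ↔ p ≤ s + a' := fun p hp => by
      rw [← glue_split_index h1 (show 1 ≤ n - a by omega) (by omega) hA hB hp,
        ← glue_split_index h1' (show 1 ≤ n - a' by omega) (by omega) hA' hB' hp, h]
    have k1 := key (s + a) (Finset.mem_Icc.2 (by omega))
    have k2 := key (s + a') (Finset.mem_Icc.2 (by omega))
    obtain rfl : a = a' := by omega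
    have eA : A = A' := by
      rw [← restrict_glue_left (n := n) h1 hA hB, h, restrict_glue_left h1 hA' hB']
    have eB : B = B' := by
      rw [← restrict_glue_right (n := n) h1 (show 1 ≤ n - a by omega) (by omega) hA hB, h,
        restrict_glue_right h1 (show 1 ≤ n - a by omega) (by omega) hA' hB']
    subst eA eB
    rfl
  · intro M hM
    obtain ⟨a, b, ha, hb, hab, hmin, hA, hB, hglue⟩ := optRaces_split hc hn hM
    obtain rfl : b = n - a := by omega
    exact ⟨⟨⟨a, (mem_indexSet_iff' hc hab ha hb).2 hmin⟩, ⟨_, hA⟩, ⟨_, hB⟩⟩, trivial, hglue⟩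

/-- Finiteness gives `ncard` its intended meaning (it is 0 on infinite sets), and nonemptiness shows
that the bound is attained. -/
theorem optRaces_finite_and_nonempty (hc : 1 ≤ c) {n : ℕ} (hn : 1 ≤ n) (s : ℤ) :
    (optRaces c s n).Finite ∧ (optRaces c s n).Nonempty := by
  induction n using Nat.strong_induction_on generalizing s with
  | _ n ih =>
    rcases hn.eq_or_lt with rfl | hn
    · rw [optRaces_one]
      exact ⟨Set.finite_singleton _, Set.singleton_nonempty _⟩
    · have hbij := glueMap_bijOn hc s (show 2 ≤ n by omega)
      have hmem := fun a (h : a ∈ indexSet c n) => (mem_indexSet_iff hc (by omega)).1 h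
      constructor
      · rw [← hbij.image_eq]
        have h1 : ∀ a : {a // a ∈ indexSet c n}, Finite (optRaces c s a) := fun a =>
          (ih a (hmem a a.2).2.1 (hmem a a.2).1 s).1.to_subtype
        have h2 : ∀ a : {a // a ∈ indexSet c n}, Finite (optRaces c (s + (a : ℕ)) (n - a)) :=
          fun a => (ih (n - a) (by have := hmem a a.2; omega)
            (by have := hmem a a.2; omega) _).1.to_subtype
        exact Set.toFinite _
      · obtain ⟨a, ha⟩ := indexSet_nonempty hc (show 2 ≤ n by omega)
        have h0 := hmem a ha
        obtain ⟨A, hA⟩ := (ih a h0.2.1 h0.1 s).2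
        obtain ⟨B, hB⟩ := (ih (n - a) (by omega) (by omega) (s + a)).2
        exact ⟨_, hbij.mapsTo (Set.mem_univ ⟨⟨a, ha⟩, ⟨A, hA⟩, ⟨B, hB⟩⟩)⟩

theorem card_optRaces_eq_sum (hc : 1 ≤ c) {n : ℕ} (hn : 2 ≤ n) (s : ℤ) :
    (optRaces c s n).ncard =
      ∑ a ∈ indexSet c n, (optRaces c s a).ncard * (optRaces c (s + a) (n - a)).ncard := by
  have hbij := glueMap_bijOn hc s hn
  have hmem := fun a (h : a ∈ indexSet c n) => (mem_indexSet_iff hc (by omega)).1 h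
  have h1 : ∀ a : {a // a ∈ indexSet c n}, Finite (optRaces c s a) := fun a =>
    (optRaces_finite_and_nonempty hc (hmem a a.2).1 s).1.to_subtype
  have h2 : ∀ a : {a // a ∈ indexSet c n}, Finite (optRaces c (s + (a : ℕ)) (n - a)) :=
    fun a => (optRaces_finite_and_nonempty hc (by have := hmem a a.2; omega) _).1.to_subtype
  rw [← hbij.image_eq, hbij.injOn.ncard_image, Set.ncard_univ, Nat.card_sigma,
    ← Finset.sum_coe_sort (indexSet c n)
      (fun a => (optRaces c s a).ncard * (optRaces c (s + a) (n - a)).ncard)]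
  exact Finset.sum_congr rfl fun a _ => Nat.card_prod _ _

/-- The recursion sums over an index set independent of s, so no explicit translation of races is
needed. -/
theorem card_optRaces_shift (hc : 1 ≤ c) {n : ℕ} (hn : 1 ≤ n) (s : ℤ) :
    (optRaces c s n).ncard = (optRaces c 0 n).ncard := by
  induction n using Nat.strong_induction_on generalizing s with
  | _ n ih =>
    rcases hn.eq_or_lt with rfl | hn
    · rw [optRaces_one, optRaces_one]
    · rw [card_optRaces_eq_sum hc hn, card_optRaces_eq_sum hc hn]
      refine Finset.sum_congr rfl fun a ha => ?_
      have h0 := (mem_indexSet_iff hc (by omega)).1 ha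
      rw [ih a h0.2.1 h0.1 s, ih (n - a) (by omega) (by omega) (s + a),
        ih (n - a) (by omega) (by omega) (0 + a)]

end OptimalRace

/-! ### From move functions to lists of iterations, and the count o_c -/

section RaceList

variable {c : ℕ}

/-- The moving pawns of a race as a function of the time. -/
def movesAt (r : List (Finset ℤ)) (t : ℕ) : Finset ℤ := r.getD t ∅

theorem traj_shift (F : ℕ → ℤ → ℤ) (t : ℕ) (y : ℤ) :
    traj F (t + 1) y = traj (fun s => F (s + 1)) t (F 0 y) := by
  induction t with
  | zero => rfl
  | succ t ih => rw [traj, ih]; rfl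

theorem raceMove_cons_succ (M : Finset ℤ) (r : List (Finset ℤ)) :
    (fun t => raceMove (movesAt (M :: r)) (t + 1)) = raceMove (movesAt r) := by
  funext t y
  simp [raceMove, movesAt]

theorem pawnStep_eq_image {S M : Finset ℤ} (h : M ⊆ S) (r : List (Finset ℤ)) :
    pawnStep S M = S.image (raceMove (movesAt (M :: r)) 0) := by
  ext y
  simp only [pawnStep, Finset.mem_union, Finset.mem_sdiff, Finset.mem_image, raceMove, movesAt,
    List.getD_cons_zero]
  constructor
  · rintro (⟨h1, h2⟩ | ⟨x, h1, rfl⟩)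
    · exact ⟨y, h1, if_neg h2⟩
    · exact ⟨x, h h1, if_pos h1⟩
  · rintro ⟨x, h1, h2⟩
    split_ifs at h2 with h3
    · exact Or.inr ⟨x, h3, h2⟩
    · exact Or.inl ⟨h2 ▸ h1, h2 ▸ h3⟩

theorem image_traj_cons {S M : Finset ℤ} (h : M ⊆ S) (r : List (Finset ℤ)) (t : ℕ) :
    S.image (traj (raceMove (movesAt (M :: r))) (t + 1)) =
      (pawnStep S M).image (traj (raceMove (movesAt r)) t) := by
  rw [pawnStep_eq_image h r, Finset.image_image]
  refine Finset.image_congr fun y _ => ?_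
  rw [traj_shift, raceMove_cons_succ]
  rfl

theorem isPawnRace_iff (S : Finset ℤ) (r : List (Finset ℤ)) :
    IsPawnRace S r ↔
      (∀ t < r.length, movesAt r t ⊆ S.image (traj (raceMove (movesAt r)) t)) ∧
        (S.image (traj (raceMove (movesAt r)) r.length)).card = 1 := by
  induction r generalizing S with
  | nil => simp [IsPawnRace, traj]
  | cons M r ih =>
    have h0 : S.image (traj (raceMove (movesAt (M :: r))) 0) = S := by simp [traj]
    rw [IsPawnRace, List.length_cons]
    constructor
    · rintro ⟨hM, hr⟩
      obtain ⟨h1, h2⟩ := (ih _).1 hr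
      rw [image_traj_cons hM]
      refine ⟨fun t ht => ?_, h2⟩
      cases t with
      | zero => rw [h0]; exact hM
      | succ t =>
        rw [image_traj_cons hM]
        exact h1 t (by omega)
    · rintro ⟨h1, h2⟩
      have hM : M ⊆ S := by
        have := h1 0 (by omega)
        rwa [h0] at this
      refine ⟨hM, (ih _).2 ⟨fun t ht => ?_, ?_⟩⟩
      · rw [← image_traj_cons hM]
        exact h1 (t + 1) (by omega)
      · rwa [← image_traj_cons hM]

theorem pawnRaceCost_eq {S : Finset ℤ} {r : List (Finset ℤ)} (h : IsPawnRace S r) :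
    (pawnRaceCost c S r : ℤ) =
      groupCost c (raceMove (movesAt r)) raceVisits S r.length := by
  induction r generalizing S with
  | nil => simp [pawnRaceCost, groupCost]
  | cons M r ih =>
    obtain ⟨hM, hr⟩ := h
    rw [pawnRaceCost, groupCost, List.length_cons, Finset.sum_range_succ']
    push_cast
    rw [ih hr, groupCost, add_comm]
    congr 1
    · refine Finset.sum_congr rfl fun t _ => ?_
      rw [image_traj_cons hM]
      refine Finset.sum_congr rfl fun y _ => ?_
      have := congrFun (congrFun (raceMove_cons_succ M r) t) y
      simp only [stepCost, raceVisits, this]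
      push_cast
      ring
    · have h0 : S.image (traj (raceMove (movesAt (M :: r))) 0) = S := by simp [traj]
      have h1 : ∀ y ∈ S, stepCost c (raceMove (movesAt (M :: r))) raceVisits 0 y =
          c + if y ∈ M then 1 else 0 := by
        intro y _
        simp only [stepCost, raceVisits, raceMove, movesAt, List.getD_cons_zero]
        split_ifs <;> push_cast <;> ring
      rw [h0, Finset.sum_congr rfl h1, Finset.sum_add_distrib, Finset.sum_const,
        Finset.sum_ite_mem, Finset.inter_eq_right.2 hM, Finset.sum_const,
        Finset.card_sdiff_of_subset hM, nsmul_eq_mul, nsmul_eq_mul]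
      push_cast [Finset.card_le_card hM]
      ring

theorem isPawnRace_block_iff {n : ℕ} (hn : 1 ≤ n) (r : List (Finset ℤ)) :
    IsPawnRace (Finset.Icc 1 (n : ℤ)) r ↔
      (∀ t < r.length, movesAt r t ⊆ (block 0 n).image (traj (raceMove (movesAt r)) t)) ∧
        ∃ z, ∀ p ∈ block 0 n, traj (raceMove (movesAt r)) r.length p = z := by
  rw [isPawnRace_iff, show Finset.Icc 1 (n : ℤ) = block 0 n by simp [block]]
  refine and_congr_right fun _ => ?_
  rw [Finset.card_eq_one]
  have hne : (block 0 n).Nonempty := ⟨1, Finset.mem_Icc.2 (by omega)⟩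
  constructor
  · rintro ⟨z, hz⟩
    exact ⟨z, fun p hp => Finset.mem_singleton.1 (hz ▸ Finset.mem_image_of_mem _ hp)⟩
  · rintro ⟨z, hz⟩
    refine ⟨z, Finset.eq_singleton_iff_unique_mem.2 ⟨?_, ?_⟩⟩
    · obtain ⟨p, hp⟩ := hne
      exact Finset.mem_image.2 ⟨p, hp, hz p hp⟩
    · intro y hy
      obtain ⟨p, hp, rfl⟩ := Finset.mem_image.1 hy
      exact hz p hp

theorem pawnRaceCost_block {n : ℕ} {r : List (Finset ℤ)}
    (h : IsPawnRace (Finset.Icc 1 (n : ℤ)) r) :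
    (pawnRaceCost c (Finset.Icc 1 (n : ℤ)) r : ℤ) =
      groupCost c (raceMove (movesAt r)) raceVisits (block 0 n) r.length := by
  rw [pawnRaceCost_eq h, show Finset.Icc 1 (n : ℤ) = block 0 n by simp [block]]

/-- The bound exceeds `minCost c n` by c times the superfluous iterations plus the superfluous
moves. Equality therefore forces n - 1 iterations and the final position n. -/
theorem minCost_le_pawnRaceCost (hc : 1 ≤ c) {n : ℕ} (hn : 1 ≤ n) {r : List (Finset ℤ)}
    (h : IsPawnRace (Finset.Icc 1 (n : ℤ)) r) :
    minCost c n ≤ pawnRaceCost c (Finset.Icc 1 (n : ℤ)) r ∧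
      (pawnRaceCost c (Finset.Icc 1 (n : ℤ)) r = minCost c n → movesAt r ∈ optRaces c 0 n ∧
        r.length = n - 1) := by
  obtain ⟨h1, z, hz⟩ := (isPawnRace_block_iff hn r).1 h
  have h2 := pawnRaceCost_block (c := c) h
  have h3 := raceCost_ge hc hn hz
  obtain ⟨h4, h5⟩ := time_of_merged hn hz
  have h6 : 0 ≤ (c : ℤ) * (r.length - (n - 1)) := mul_nonneg (by positivity) (by omega)
  refine ⟨by omega, fun h7 => ?_⟩
  have h8 : (c : ℤ) * (r.length - (n - 1)) = 0 := by omega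
  have hlen : r.length = n - 1 := by
    rcases mul_eq_zero.1 h8 with h | h <;> omega
  have hz' : z = 0 + n := by omega
  subst hz'
  refine ⟨⟨hlen ▸ h1, fun t ht => List.getD_eq_default _ _ (by omega), hlen ▸ hz, ?_⟩, hlen⟩
  rw [← hlen, ← h2, h7, h8]
  ring

theorem exists_list_of_mem_optRaces {n : ℕ} (hn : 1 ≤ n) {M : ℕ → Finset ℤ}
    (hM : M ∈ optRaces c 0 n) : ∃ r : List (Finset ℤ), movesAt r = M ∧
      IsPawnRace (Finset.Icc 1 (n : ℤ)) r ∧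
      pawnRaceCost c (Finset.Icc 1 (n : ℤ)) r = minCost c n := by
  have e : movesAt ((List.range (n - 1)).map M) = M := by
    funext t
    rcases lt_or_ge t (n - 1) with ht | ht
    · simp [movesAt, ht]
    · rw [hM.2.1 t ht]
      exact List.getD_eq_default _ _ (by simpa using ht)
  have hr : IsPawnRace (Finset.Icc 1 (n : ℤ)) ((List.range (n - 1)).map M) := by
    rw [isPawnRace_block_iff hn, e]
    simp only [List.length_map, List.length_range]
    exact ⟨hM.1, _, hM.2.2.1⟩
  refine ⟨_, e, hr, ?_⟩
  have := pawnRaceCost_block (c := c) hr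
  rw [e] at this
  simp only [List.length_map, List.length_range] at this
  rw [hM.2.2.2] at this
  push_cast [hn] at this
  zify
  rw [this]
  ring

/-- `movesAt` forgets trailing empty sets, but all optimal lists have length n - 1, so it is
injective on them. -/
theorem numOptimalRaces_eq (hc : 1 ≤ c) {n : ℕ} (hn : 1 ≤ n) :
    numOptimalRaces c n = (optRaces c 0 n).ncard := by
  have hopt : ∀ r, IsOptimalPawnRace c n r ↔ IsPawnRace (Finset.Icc 1 (n : ℤ)) r ∧
      pawnRaceCost c (Finset.Icc 1 (n : ℤ)) r = minCost c n := by
    intro r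
    refine and_congr_right fun hr => ⟨fun h => ?_, fun h s hs => ?_⟩
    · obtain ⟨M, hM⟩ := (optRaces_finite_and_nonempty hc hn 0).2
      obtain ⟨s, -, hs, hcost⟩ := exists_list_of_mem_optRaces hn hM
      exact le_antisymm (hcost ▸ h s hs) (minCost_le_pawnRaceCost hc hn hr).1
    · rw [h]
      exact (minCost_le_pawnRaceCost hc hn hs).1
  have hbij : Set.BijOn movesAt {r | IsOptimalPawnRace c n r} (optRaces c 0 n) := by
    refine ⟨?_, ?_, ?_⟩
    · intro r hr
      obtain ⟨h1, h2⟩ := (hopt r).1 hr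
      exact ((minCost_le_pawnRaceCost hc hn h1).2 h2).1
    · intro r hr r' hr' h
      obtain ⟨h1, h2⟩ := (hopt r).1 hr
      obtain ⟨h1', h2'⟩ := (hopt r').1 hr'
      have l := ((minCost_le_pawnRaceCost hc hn h1).2 h2).2
      have l' := ((minCost_le_pawnRaceCost hc hn h1').2 h2').2
      refine List.ext_getElem (by omega) fun t ht ht' => ?_
      have := congrFun h t
      simpa [movesAt, ht, ht'] using this
    · intro M hM
      obtain ⟨r, h1, h2⟩ := exists_list_of_mem_optRaces hn hM
      exact ⟨r, (hopt r).2 h2, h1⟩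
  rw [numOptimalRaces, ← hbij.image_eq, hbij.injOn.ncard_image]

theorem numOptimalRaces_one (hc : 1 ≤ c) : numOptimalRaces c 1 = 1 := by
  rw [numOptimalRaces_eq hc le_rfl, optRaces_one, Set.ncard_singleton]

theorem numOptimalRaces_pos (hc : 1 ≤ c) {n : ℕ} (hn : 1 ≤ n) : 1 ≤ numOptimalRaces c n := by
  rw [numOptimalRaces_eq hc hn]
  obtain ⟨h1, h2⟩ := optRaces_finite_and_nonempty hc hn 0
  exact (Set.ncard_pos h1).2 h2

theorem numOptimalRaces_eq_sum (hc : 1 ≤ c) {n : ℕ} (hn : 2 ≤ n) :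
    numOptimalRaces c n =
      ∑ i ∈ indexSet c n, numOptimalRaces c (n - i) * numOptimalRaces c i := by
  rw [numOptimalRaces_eq hc (by omega), card_optRaces_eq_sum hc hn]
  refine Finset.sum_congr rfl fun i hi => ?_
  have h := (mem_indexSet_iff hc hn).1 hi
  rw [numOptimalRaces_eq hc h.1, numOptimalRaces_eq hc (by omega),
    card_optRaces_shift hc (by omega) (0 + i), mul_comm]

/-- A sum of positive products is 1 only if it has one term with both factors 1. If n exceeds
p_{k-1} + p_k, the bottom of the box range, then either I_n has two elements or one of the parts
lies strictly between consecutive terms of p_c. -/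
theorem numOptimalRaces_eq_one_iff (hc : 1 ≤ c) {n : ℕ} (hn : 1 ≤ n) :
    numOptimalRaces c n = 1 ↔ ∃ k, 1 ≤ k ∧ n = pSeq c k := by
  induction n using Nat.strong_induction_on with
  | _ n ih =>
    rcases hn.eq_or_lt with rfl | hn
    · simp only [numOptimalRaces_one hc, true_iff]
      exact ⟨1, le_rfl, (pSeq_of_le (by omega)).symm⟩
    obtain ⟨hk, hlo, hhi⟩ := box_of_mSeq hc hn rfl
    have hmem : ∀ i, i ∈ indexSet c n ↔
        i ≤ n ∧ IsOptSplit c (mSeq c n - c - 1) i (n - i) := by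
      simp [indexSet, IsOptSplit]
    have hidx := fun i (h : i ∈ indexSet c n) => (mem_indexSet_iff hc hn).1 h
    have hm : mSeq c n - 1 = mSeq c n - c - 1 + c := by omega
    rw [exists_eq_pSeq_iff hc (by omega), hm, pSeq_add hc hk]
    set k := mSeq c n - c - 1
    have q1 : pSeq c (k - 1) ≤ pSeq c k := pSeq_mono hc (by omega)
    have q2 : pSeq c k ≤ pSeq c (k + 1) := pSeq_mono hc (by omega)
    have p1 := pSeq_pos c (k - 1)
    rw [numOptimalRaces_eq_sum hc hn]
    have pos : ∀ i ∈ indexSet c n, 1 ≤ numOptimalRaces c (n - i) * numOptimalRaces c i := by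
      intro i hi
      have := hidx i hi
      exact Nat.mul_pos (numOptimalRaces_pos hc (by omega)) (numOptimalRaces_pos hc this.1)
    have isP : ∀ j, 1 ≤ j → numOptimalRaces c (pSeq c j) ≠ 1 → n ≤ pSeq c j := by
      intro j hj h
      by_contra hcon
      exact h ((ih _ (by omega) (pSeq_pos c j)).2 ⟨j, hj, rfl⟩)
    constructor
    · intro hsum
      by_contra hne
      -- two different splits, or a split whose larger or smaller part is not a term of `p`
      have huniq : ∀ i ∈ indexSet c n, ∀ j ∈ indexSet c n, i = j := by
        intro i hi j hj
        by_contra hij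
        have h1 := Finset.sum_le_sum_of_subset
          (f := fun i => numOptimalRaces c (n - i) * numOptimalRaces c i)
          (show ({i, j} : Finset ℕ) ⊆ indexSet c n by
            intro x hx
            rcases Finset.mem_insert.1 hx with rfl | hx
            · exact hi
            · rwa [Finset.mem_singleton.1 hx])
        rw [Finset.sum_pair hij, hsum] at h1
        have := pos i hi
        have := pos j hj
        omega
      have hone : ∀ i ∈ indexSet c n, numOptimalRaces c (n - i) = 1 ∧ numOptimalRaces c i = 1 := by
        intro i hi
        have h1 : indexSet c n = {i} :=
          Finset.eq_singleton_iff_unique_mem.2 ⟨hi, fun j hj => huniq j hj i hi⟩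
        rw [h1, Finset.sum_singleton] at hsum
        exact mul_eq_one.1 hsum
      have hbetween : ∀ i q, 1 ≤ i → i < n → numOptimalRaces c i = 1 → pSeq c q < i →
          ¬ i < pSeq c (q + 1) := by
        intro i q hi hin h1 h2 h3
        obtain ⟨j, -, rfl⟩ := (ih i hin hi).1 h1
        rcases le_or_gt j q with h | h
        · have := pSeq_mono hc h
          omega
        · have := pSeq_mono hc (show q + 1 ≤ j from h)
          omega
      -- The two ends of the interval I_n; uniqueness makes them equal.
      have hmax : max (pSeq c k) (n - pSeq c k) ∈ indexSet c n := by
        rw [hmem]; unfold IsOptSplit; omega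
      have hmin : min (pSeq c (k + 1)) (n - pSeq c (k - 1)) ∈ indexSet c n := by
        rw [hmem]; unfold IsOptSplit; omega
      have heq := huniq _ hmax _ hmin
      have h1 := hone _ hmax
      have h2 := hidx _ hmax
      -- If p_{k-1} = p_k, the larger part n - p_k lies strictly between p_k and p_{k+1}. If only
      -- p_k = p_{k+1}, the smaller part lies strictly between p_{k-1} and p_k. If both inequalities
      -- are strict, the ends differ.
      rcases q1.eq_or_lt with e1 | l1
      · refine hbetween _ k h2.1 h2.2.1 h1.2 (by omega) (by omega)
      · rcases q2.eq_or_lt with e2 | l2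
        · refine hbetween _ (k - 1) (by omega) (by omega) h1.1 (by omega) ?_
          rw [show k - 1 + 1 = k by omega]
          omega
        · omega
    · intro h
      -- For n = p_{k-1} + p_k the box conditions b ≥ p_{k-1} and a ≥ p_k leave only its lower
      -- corner.
      have h1 : indexSet c n = {pSeq c k} := by
        ext i
        rw [hmem, Finset.mem_singleton]
        unfold IsOptSplit
        omega
      rw [h1, Finset.sum_singleton, mul_eq_one, h, Nat.add_sub_cancel]
      have a1 := isP (k - 1) (by omega)
      have a2 := isP k (by omega)
      have p2 := pSeq_pos c k
      constructor
      · by_contra hcon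
        have := a1 hcon
        omega
      · by_contra hcon
        have := a2 hcon
        omega

end RaceList

/-! ### Reduction of synchronizing words to the states 1, ..., N -/

section Synchronization

variable {c : ℕ}

/-- The word `w` maps all states of `Q` to the same state. -/
def PFA.Syncs {α σ : Type} (A : PFA α σ) (Q : Set σ) (w : List α) : Prop :=
  ∃ s, ∀ q ∈ Q, A.run q w = some s

/-- `w` is a shortest word that maps all states of `Q` to the same state. -/
def PFA.IsShortest {α σ : Type} (A : PFA α σ) (Q : Set σ) (w : List α) : Prop :=
  A.Syncs Q w ∧ ∀ v, A.Syncs Q v → w.length ≤ v.length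

theorem PFA.run_nil {α σ : Type} (A : PFA α σ) (q : σ) : A.run q [] = some q := rfl

theorem PFA.run_cons {α σ : Type} (A : PFA α σ) (q : σ) (x : α) (w : List α) :
    A.run q (x :: w) = (A.step q x).bind fun r => A.run r w := by
  simp [PFA.run, List.foldlM_cons]

theorem PFA.run_append {α σ : Type} (A : PFA α σ) (q : σ) (v w : List α) :
    A.run q (v ++ w) = (A.run q v).bind fun r => A.run r w := by
  simp [PFA.run, List.foldlM_append]

theorem PFA.Syncs.of_cons {α σ : Type} {A : PFA α σ} {Q Q' : Set σ} {x : α} {w : List α}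
    (h : A.Syncs Q (x :: w)) (hQ : ∀ r ∈ Q', ∃ q ∈ Q, A.step q x = some r) : A.Syncs Q' w := by
  obtain ⟨s, hs⟩ := h
  refine ⟨s, fun r hr => ?_⟩
  obtain ⟨q, hq, hqr⟩ := hQ r hr
  have := hs q hq
  rwa [PFA.run_cons, hqr] at this

theorem PFA.Syncs.step_ne_none {α σ : Type} {A : PFA α σ} {Q : Set σ} {x : α} {w : List α}
    (h : A.Syncs Q (x :: w)) {q : σ} (hq : q ∈ Q) : A.step q x ≠ none := by
  obtain ⟨s, hs⟩ := h
  intro h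
  have := hs q hq
  rw [PFA.run_cons, h] at this
  simp at this

theorem PFA.Syncs.append {α σ : Type} {A : PFA α σ} {Q Q' : Set σ} {u v : List α}
    (h : A.Syncs Q' v) (hQ : ∀ q ∈ Q, ∃ r ∈ Q', A.run q u = some r) : A.Syncs Q (u ++ v) := by
  obtain ⟨s, hs⟩ := h
  refine ⟨s, fun q hq => ?_⟩
  obtain ⟨r, hr, hqr⟩ := hQ q hq
  rw [PFA.run_append, hqr]
  exact hs r hr

section Cerny

variable {N : ℕ}

theorem step_a_low {q : ℕ} (h : q ≤ N) :
    (cernyPFA c (N + c + 1)).step q .a = some (q + 1) := by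
  simp only [cernyPFA, cernyStep]
  rw [if_pos (by omega)]

theorem step_a_mid {q : ℕ} (h : N < q) (h' : q ≤ N + c) :
    (cernyPFA c (N + c + 1)).step q .a = none := by
  simp only [cernyPFA, cernyStep]
  rw [if_neg (by omega), if_pos (by omega)]

theorem step_a_top : (cernyPFA c (N + c + 1)).step (N + c + 1) .a = some 1 := by
  simp only [cernyPFA, cernyStep]
  rw [if_neg (by omega), if_neg (by omega)]

theorem step_b_low {q : ℕ} (h : q ≤ N) : (cernyPFA c (N + c + 1)).step q .b = some q := by
  simp only [cernyPFA, cernyStep]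
  rw [if_pos (by omega)]

theorem step_b_mid {q : ℕ} (h : N < q) (h' : q ≤ N + c) :
    (cernyPFA c (N + c + 1)).step q .b = some (q + 1) := by
  simp only [cernyPFA, cernyStep]
  rw [if_neg (by omega), if_pos (by omega)]

theorem step_b_top : (cernyPFA c (N + c + 1)).step (N + c + 1) .b = some 1 := by
  simp only [cernyPFA, cernyStep]
  rw [if_neg (by omega), if_neg (by omega)]

theorem run_b_low {q : ℕ} (h : q ≤ N) (m : ℕ) :
    (cernyPFA c (N + c + 1)).run q (List.replicate m .b) = some q := by
  induction m with
  | zero => rfl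
  | succ m ih => rw [List.replicate_succ, PFA.run_cons, step_b_low h, Option.bind_some, ih]

theorem run_b_mid {q m : ℕ} (h : N < q) (h' : q + m ≤ N + c + 1) :
    (cernyPFA c (N + c + 1)).run q (List.replicate m .b) = some (q + m) := by
  induction m generalizing q with
  | zero => rfl
  | succ m ih =>
    rw [List.replicate_succ, PFA.run_cons, step_b_mid h (by omega), Option.bind_some,
      ih (by omega) (by omega)]
    congr 1
    omega

theorem run_b_long {q m : ℕ} (hN : 1 ≤ N) (h : N < q) (hq : q ≤ N + c + 1)
    (h' : N + c + 1 < q + m) :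
    (cernyPFA c (N + c + 1)).run q (List.replicate m .b) = some 1 := by
  obtain ⟨k, rfl⟩ : ∃ k, m = (N + c + 1 - q) + (1 + k) := ⟨m - (N + c + 1 - q) - 1, by omega⟩
  rw [List.replicate_add, PFA.run_append, run_b_mid h (by omega), Option.bind_some,
    show q + (N + c + 1 - q) = N + c + 1 by omega, List.replicate_add, PFA.run_append,
    show List.replicate 1 Letter.b = [Letter.b] from rfl, PFA.run_cons, step_b_top]
  exact run_b_low hN k

/-- A word that synchronizes the states which remain after `b ^ i`, or which remain after
`b ^ c * a * b ^ i`, can be shortened to a word which starts with `b`'s only. -/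
theorem exists_shorter_of_syncs (hN : 1 ≤ N) (w : List Letter) {i : ℕ} (hi : i ≤ c)
    (h : (cernyPFA c (N + c + 1)).Syncs
        {q | (1 ≤ q ∧ q ≤ N) ∨ (N + 1 + i ≤ q ∧ q ≤ N + c + 1)} w ∨
      (cernyPFA c (N + c + 1)).Syncs {q | (1 ≤ q ∧ q ≤ N) ∨ q = N + 1 + i} w) :
    ∃ v, (cernyPFA c (N + c + 1)).Syncs {q | 1 ≤ q ∧ q ≤ N} v ∧
      v.length + (c + 1 - i) ≤ w.length ∧
      (v.length + (c + 1 - i) = w.length → w = List.replicate (c + 1 - i) .b ++ v) := by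
  induction w generalizing i with
  | nil =>
    exfalso
    rcases h with ⟨s, hs⟩ | ⟨s, hs⟩
    · have h1 := hs 1 (Or.inl ⟨le_rfl, hN⟩)
      have h2 := hs (N + 1 + i) (Or.inr ⟨le_rfl, by omega⟩)
      rw [PFA.run_nil, Option.some_inj] at h1 h2
      omega
    · have h1 := hs 1 (Or.inl ⟨le_rfl, hN⟩)
      have h2 := hs (N + 1 + i) (Or.inr rfl)
      rw [PFA.run_nil, Option.some_inj] at h1 h2
      omega
  | cons x w ih =>
    cases x with
    | a =>
      rcases hi.eq_or_lt with rfl | hi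
      · have h' : (cernyPFA i (N + i + 1)).Syncs {q | (1 ≤ q ∧ q ≤ N) ∨ q = N + 1 + 0} w := by
          have hQ : ∀ r ∈ {q | (1 ≤ q ∧ q ≤ N) ∨ q = N + 1 + 0},
              ∃ q, ((1 ≤ q ∧ q ≤ N) ∨ q = N + i + 1) ∧
                (cernyPFA i (N + i + 1)).step q .a = some r := by
            intro r hr
            rw [Set.mem_ofPred_eq] at hr
            rcases Nat.eq_or_lt_of_le (show 1 ≤ r by omega) with rfl | hr1
            · exact ⟨N + i + 1, Or.inr rfl, step_a_top⟩
            · refine ⟨r - 1, Or.inl (by omega), ?_⟩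
              rw [step_a_low (by omega), show r - 1 + 1 = r by omega]
          rcases h with h | h
          · refine h.of_cons fun r hr => ?_
            obtain ⟨q, hq, hqr⟩ := hQ r hr
            exact ⟨q, by rw [Set.mem_ofPred_eq]; omega, hqr⟩
          · refine h.of_cons fun r hr => ?_
            obtain ⟨q, hq, hqr⟩ := hQ r hr
            exact ⟨q, by rw [Set.mem_ofPred_eq]; omega, hqr⟩
        -- The letter a after b^c puts a pawn on N + 1 again while 1, ..., N stay occupied, so the
        -- count restarts at i = 0. This detour is strictly wasteful, and the equality clause is
        -- vacuous.
        obtain ⟨v, h1, h2, -⟩ := ih (Nat.zero_le _) (Or.inr h')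
        refine ⟨v, h1, ?_, fun h3 => ?_⟩ <;> simp only [List.length_cons] at * <;> omega
      -- Before c letters b have been read, the state N + 1 + i is occupied and has no transition by
      -- a.
      · exfalso
        rcases h with h | h
        · exact h.step_ne_none (q := N + 1 + i) (Or.inr ⟨le_rfl, by omega⟩)
            (step_a_mid (by omega) (by omega))
        · exact h.step_ne_none (q := N + 1 + i) (Or.inr rfl) (step_a_mid (by omega) (by omega))
    | b =>
      rcases hi.eq_or_lt with rfl | hi
      · refine ⟨w, ?_, by simp, fun _ => by simp⟩
        rcases h with h | h
        · exact h.of_cons fun r hr => ⟨r, Or.inl hr, step_b_low hr.2⟩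
        · exact h.of_cons fun r hr => ⟨r, Or.inl hr, step_b_low hr.2⟩
      · obtain ⟨v, h1, h2, h3⟩ := ih (i := i + 1) hi (h.imp
          (fun h => h.of_cons fun r hr => by
            rcases hr with hr | hr
            · exact ⟨r, Or.inl hr, step_b_low hr.2⟩
            · refine ⟨r - 1, Or.inr (by omega), ?_⟩
              rw [step_b_mid (by omega) (by omega), show r - 1 + 1 = r by omega])
          (fun h => h.of_cons fun r hr => by
            rcases hr with hr | hr
            · exact ⟨r, Or.inl hr, step_b_low hr.2⟩
            · refine ⟨r - 1, Or.inr (by omega), ?_⟩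
              rw [step_b_mid (by omega) (by omega), show r - 1 + 1 = r by omega]))
        have e : c + 1 - i = c + 1 - (i + 1) + 1 := by omega
        refine ⟨v, h1, ?_, fun h4 => ?_⟩
        · rw [List.length_cons]; omega
        · rw [List.length_cons] at h4
          rw [e, List.replicate_succ, List.cons_append, ← h3 (by omega)]

/-- The word b^(c+1) maps all states into 1, ..., N, and `exists_shorter_of_syncs` shows that no
shortest word can begin otherwise. -/
theorem isShortestSynchronizing_iff (hN : 1 ≤ N) (w : List Letter) :
    (cernyPFA c (N + c + 1)).IsShortestSynchronizing w ↔
      ∃ v, (cernyPFA c (N + c + 1)).IsShortest {q | 1 ≤ q ∧ q ≤ N} v ∧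
        w = List.replicate (c + 1) .b ++ v := by
  have hlow : ∀ q, 1 ≤ q → q ≤ N + c + 1 → ∃ r ∈ {q | 1 ≤ q ∧ q ≤ N},
      (cernyPFA c (N + c + 1)).run q (List.replicate (c + 1) .b) = some r := by
    intro q h1 h2
    rcases le_or_gt q N with h | h
    · exact ⟨q, ⟨h1, h⟩, run_b_low h _⟩
    · exact ⟨1, ⟨le_rfl, hN⟩, run_b_long hN h h2 (by omega)⟩
  have hup : ∀ v, (cernyPFA c (N + c + 1)).Syncs {q | 1 ≤ q ∧ q ≤ N} v →
      (cernyPFA c (N + c + 1)).IsSynchronizing (List.replicate (c + 1) .b ++ v) := by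
    intro v hv
    have h1 : (cernyPFA c (N + c + 1)).Syncs {q | 1 ≤ q ∧ q ≤ N + c + 1}
        (List.replicate (c + 1) .b ++ v) := hv.append fun q hq => hlow q hq.1 hq.2
    obtain ⟨s, hs⟩ := h1
    have hmem : ∀ (w : List Letter) (q s : ℕ), q ∈ (cernyPFA c (N + c + 1)).states →
        (cernyPFA c (N + c + 1)).run q w = some s → s ∈ (cernyPFA c (N + c + 1)).states := by
      intro w
      induction w with
      | nil =>
        intro q s hq h
        rw [PFA.run_nil, Option.some_inj] at h
        exact h ▸ hq
      | cons x w ih =>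
        intro q s hq h
        rw [PFA.run_cons, Option.bind_eq_some_iff] at h
        obtain ⟨r, hr, h⟩ := h
        exact ih r s (PFA.step_mem _ q hq x r hr) h
    refine ⟨s, hmem _ 1 s (Finset.mem_Icc.2 (by omega)) (hs 1 (by simp)), fun q hq => ?_⟩
    exact hs q (Finset.mem_Icc.1 hq)
  have hdown : ∀ w, (cernyPFA c (N + c + 1)).IsSynchronizing w →
      ∃ v, (cernyPFA c (N + c + 1)).Syncs {q | 1 ≤ q ∧ q ≤ N} v ∧
        v.length + (c + 1) ≤ w.length ∧
        (v.length + (c + 1) = w.length → w = List.replicate (c + 1) .b ++ v) := by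
    rintro w ⟨s, -, hs⟩
    refine exists_shorter_of_syncs hN w (Nat.zero_le c) (Or.inl ⟨s, fun q hq => hs q ?_⟩)
    rw [Set.mem_ofPred_eq] at hq
    exact Finset.mem_Icc.2 (by omega)
  constructor
  · rintro ⟨h1, h2⟩
    obtain ⟨v, hv, hle, heq⟩ := hdown w h1
    have h3 := h2 _ (hup v hv)
    rw [List.length_append, List.length_replicate] at h3
    have e := heq (by omega)
    refine ⟨v, ⟨hv, fun u hu => ?_⟩, e⟩
    have h4 := h2 _ (hup u hu)
    rw [List.length_append, List.length_replicate] at h4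
    omega
  · rintro ⟨v, ⟨h1, h2⟩, rfl⟩
    refine ⟨hup v h1, fun u hu => ?_⟩
    obtain ⟨v', hv', hle, -⟩ := hdown u hu
    have := h2 v' hv'
    rw [List.length_append, List.length_replicate]
    omega

theorem existsUnique_shortestSynchronizing_iff (hN : 1 ≤ N) :
    (∃! w, (cernyPFA c (N + c + 1)).IsShortestSynchronizing w) ↔
      ∃! v, (cernyPFA c (N + c + 1)).IsShortest {q | 1 ≤ q ∧ q ≤ N} v := by
  simp only [isShortestSynchronizing_iff hN]
  constructor
  · rintro ⟨w, ⟨v, hv, rfl⟩, huniq⟩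
    exact ⟨v, hv, fun u hu => List.append_cancel_left (huniq _ ⟨u, hu, rfl⟩)⟩
  · rintro ⟨v, hv, huniq⟩
    refine ⟨_, ⟨v, hv, rfl⟩, ?_⟩
    rintro _ ⟨u, hu, rfl⟩
    rw [huniq u hu]

end Cerny

end Synchronization

/-! ### Words as blocks a b^m and the rotating frame -/

section BlockWord

variable {c : ℕ}

/-- The word `a b^(m 0) a b^(m 1) ... a b^(m (T - 1))`. -/
def blockWord (m : ℕ → ℕ) : ℕ → List Letter
  | 0 => []
  | t + 1 => blockWord m t ++ .a :: List.replicate (m t) .b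

theorem length_blockWord (m : ℕ → ℕ) (T : ℕ) :
    (blockWord m T).length = T + ∑ t ∈ Finset.range T, m t := by
  induction T with
  | zero => rfl
  | succ T ih =>
    rw [blockWord, List.length_append, ih, Finset.sum_range_succ, List.length_cons,
      List.length_replicate]
    omega

theorem blockWord_congr {m m' : ℕ → ℕ} {T : ℕ} (h : ∀ t < T, m t = m' t) :
    blockWord m T = blockWord m' T := by
  induction T with
  | zero => rfl
  | succ T ih => rw [blockWord, blockWord, ih fun t ht => h t (by omega), h T (by omega)]

theorem append_cons_replicate_inj {v v' : List Letter} {m m' : ℕ}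
    (h : v ++ .a :: List.replicate m .b = v' ++ .a :: List.replicate m' .b) :
    v = v' ∧ m = m' := by
  induction m generalizing m' with
  | zero =>
    cases m' with
    | zero => exact ⟨List.append_cancel_right h, rfl⟩
    | succ m' =>
      rw [List.replicate_succ', ← List.cons_append, ← List.append_assoc] at h
      have := (List.append_inj' h rfl).2
      simp at this
  | succ m ih =>
    cases m' with
    | zero =>
      rw [List.replicate_succ', ← List.cons_append, ← List.append_assoc] at h
      have := (List.append_inj' h rfl).2
      simp at this
    | succ m' =>
      rw [List.replicate_succ', List.replicate_succ', ← List.cons_append, ← List.append_assoc,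
        ← List.cons_append, ← List.append_assoc] at h
      obtain ⟨h1, h2⟩ := ih (List.append_inj' h rfl).1
      exact ⟨h1, by omega⟩

theorem blockWord_inj {m m' : ℕ → ℕ} {T : ℕ} (h : blockWord m T = blockWord m' T) :
    ∀ t < T, m t = m' t := by
  induction T with
  | zero => intro t ht; omega
  | succ T ih =>
    obtain ⟨h1, h2⟩ := append_cons_replicate_inj h
    intro t ht
    rcases Nat.lt_succ_iff_lt_or_eq.1 ht with h | rfl
    · exact ih h1 t h
    · exact h2

theorem exists_blockWord (w : List Letter) (hw : ∀ v, w ≠ .b :: v) :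
    ∃ m T, w = blockWord m T := by
  induction w using List.reverseRecOn with
  | nil => exact ⟨0, 0, rfl⟩
  | append_singleton w x ih =>
    have hw' : ∀ v, w ≠ .b :: v := by
      rintro v rfl
      exact hw _ rfl
    obtain ⟨m, T, rfl⟩ := ih hw'
    cases x with
    | a =>
      refine ⟨Function.update m T 0, T + 1, ?_⟩
      rw [blockWord, Function.update_self, blockWord_congr
        (m := Function.update m T 0) (m' := m) fun t ht => Function.update_of_ne ht.ne _ _]
      rfl
    | b =>
      cases T with
      | zero => exact absurd rfl (hw [])
      | succ T =>
        refine ⟨Function.update m T (m T + 1), T + 1, ?_⟩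
        rw [blockWord, blockWord, Function.update_self, blockWord_congr
          (m := Function.update m T (m T + 1)) (m' := m) fun t ht => Function.update_of_ne ht.ne _ _,
          List.replicate_succ', List.append_assoc,
          List.cons_append]

theorem blockWord_eq_append (m : ℕ → ℕ) (t k : ℕ) :
    ∃ v, blockWord m (t + k + 1) = blockWord m t ++ .a :: v := by
  induction k with
  | zero => exact ⟨_, rfl⟩
  | succ k ih =>
    obtain ⟨v, hv⟩ := ih
    refine ⟨v ++ .a :: List.replicate (m (t + k + 1)) .b, ?_⟩
    rw [← add_assoc, blockWord, hv, List.append_assoc, List.cons_append]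

/-- In a frame that rotates with the letter `a`, a pawn moves during the block `a b^m` if it
passes the states `N + 1, ..., N + c + 1` and `m ≥ c + 1`. -/
def blockMove (c N : ℕ) (m : ℕ → ℕ) (t : ℕ) (y : ℤ) : ℤ :=
  if ((N : ℤ) + 1) ∣ y + t + 1 ∧ c + 1 ≤ m t then y + 1 else y

/-- The number of times that a pawn has passed the states `N + 1, ..., N + c + 1`. -/
def blockVisits (N t : ℕ) (y : ℤ) : ℤ := (y + t) / ((N : ℤ) + 1)

/-- The state of a pawn at position `x` modulo `N + 1` between two blocks. -/
def physState (c N : ℕ) (x : ℤ) : ℕ :=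
  if ((N : ℤ) + 1) ∣ x then N + c + 1 else (x % ((N : ℤ) + 1)).toNat

section Block

variable {N : ℕ} {m : ℕ → ℕ}

theorem physState_spec (x : ℤ) :
    (((N : ℤ) + 1) ∣ x ∧ physState c N x = N + c + 1) ∨
    (¬ ((N : ℤ) + 1) ∣ x ∧ 1 ≤ physState c N x ∧ physState c N x ≤ N ∧
      (physState c N x : ℤ) = x % ((N : ℤ) + 1)) := by
  unfold physState
  split_ifs with h
  · exact Or.inl ⟨h, rfl⟩
  · have h1 := Int.emod_nonneg x (show (N : ℤ) + 1 ≠ 0 by omega)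
    have h2 := Int.emod_lt_of_pos x (show 0 < (N : ℤ) + 1 by omega)
    have h3 : x % ((N : ℤ) + 1) ≠ 0 := fun h' => h (Int.dvd_of_emod_eq_zero h')
    refine Or.inr ⟨h, by omega, by omega, by omega⟩

theorem physState_succ_of_dvd (hN : 1 ≤ N) {x : ℤ} (h : ((N : ℤ) + 1) ∣ x) :
    physState c N (x + 1) = 1 := by
  obtain ⟨k, rfl⟩ := h
  have h1 : (((N : ℤ) + 1) * k + 1) % ((N : ℤ) + 1) = 1 := by
    rw [Int.mul_add_emod_self_left, Int.emod_eq_of_lt (by omega) (by omega)]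
  rcases physState_spec (c := c) (N := N) (((N : ℤ) + 1) * k + 1) with ⟨h2, -⟩ | ⟨-, -, -, h2⟩
  · rw [Int.emod_eq_zero_of_dvd h2] at h1
    omega
  · omega

theorem step_a_physState (hN : 1 ≤ N) (x : ℤ) :
    (cernyPFA c (N + c + 1)).step (physState c N x) .a =
      some (if ((N : ℤ) + 1) ∣ x + 1 then N + 1 else physState c N (x + 1)) := by
  rcases physState_spec (c := c) (N := N) x with ⟨h1, h2⟩ | ⟨h1, h2, h3, h4⟩
  · rw [h2, step_a_top, physState_succ_of_dvd hN h1, if_neg]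
    intro h
    have := (Int.dvd_add_right h1).1 h
    have := Int.le_of_dvd one_pos this
    omega
  · rw [step_a_low h3]
    congr 1
    have h5 := Int.emod_add_mul_ediv x ((N : ℤ) + 1)
    have h6 : x + 1 = (physState c N x + 1) + ((N : ℤ) + 1) * (x / ((N : ℤ) + 1)) := by omega
    split_ifs with h
    · rw [h6, Int.dvd_add_left (dvd_mul_right _ _)] at h
      have := Int.le_of_dvd (by omega) h
      omega
    · rcases physState_spec (c := c) (N := N) (x + 1) with ⟨h7, -⟩ | ⟨-, h8, h9, h10⟩
      · exact absurd h7 h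
      · have h11 : physState c N x ≠ N := by
          intro e
          apply h
          rw [h6, e, show ((N : ℕ) : ℤ) + 1 = ((N : ℤ) + 1) * 1 by ring]
          simp only [mul_one]
          exact dvd_add dvd_rfl (dvd_mul_right _ _)
        have h12 : (x + 1) % ((N : ℤ) + 1) = physState c N x + 1 := by
          rw [h6, Int.add_mul_emod_self_left, Int.emod_eq_of_lt (by omega) (by omega)]
        omega

theorem run_block_of_not_dvd (hN : 1 ≤ N) {x : ℤ} (h : ¬ ((N : ℤ) + 1) ∣ x + 1) (k : ℕ) :
    (cernyPFA c (N + c + 1)).run (physState c N x) (.a :: List.replicate k .b) =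
      some (physState c N (x + 1)) := by
  rw [PFA.run_cons, step_a_physState hN, if_neg h, Option.bind_some]
  rcases physState_spec (c := c) (N := N) (x + 1) with ⟨h7, -⟩ | ⟨-, h8, h9, -⟩
  · exact absurd h7 h
  · exact run_b_low h9 k

/-- The letter a leads from N to N + 1, and c letters b lead on to N + c + 1, which represents
residue 0. One more b wraps round to 1, where further b's have no effect; this extra step is the
move of the pawn. -/
theorem run_block_of_dvd (hN : 1 ≤ N) {x : ℤ} (h : ((N : ℤ) + 1) ∣ x + 1) (k : ℕ) :
    (cernyPFA c (N + c + 1)).run (physState c N x) (.a :: List.replicate k .b) =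
      some (if c + 1 ≤ k then physState c N (x + 1 + 1) else N + 1 + k) := by
  rw [PFA.run_cons, step_a_physState hN, if_pos h, Option.bind_some]
  split_ifs with hk
  · rw [physState_succ_of_dvd hN h]
    exact run_b_long hN (by omega) (by omega) (by omega)
  · exact run_b_mid (by omega) (by omega)

/-- All `b`-blocks up to time `T` which the pawn starting at `y` has to pass are long enough. -/
def IsValidBlock (c N : ℕ) (m : ℕ → ℕ) (T : ℕ) (y : ℤ) : Prop :=
  ∀ t < T, ((N : ℤ) + 1) ∣ traj (blockMove c N m) t y + t + 1 → c ≤ m t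

theorem run_blockWord (hN : 1 ≤ N) {q T : ℕ} (hq : 1 ≤ q) (hqN : q ≤ N)
    (h : IsValidBlock c N m T q) :
    (cernyPFA c (N + c + 1)).run q (blockWord m T) =
      some (physState c N (traj (blockMove c N m) T q + T)) := by
  induction T with
  | zero =>
    rw [blockWord, PFA.run_nil]
    congr 1
    simp only [traj, Nat.cast_zero, add_zero]
    have h0 : (q : ℤ) % ((N : ℤ) + 1) = q := Int.emod_eq_of_lt (by omega) (by omega)
    rcases physState_spec (c := c) (N := N) q with ⟨h1, -⟩ | ⟨-, -, -, h1⟩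
    · rw [Int.emod_eq_zero_of_dvd h1] at h0
      omega
    · omega
  | succ T ih =>
    rw [blockWord, PFA.run_append, ih fun t ht => h t (by omega), Option.bind_some]
    simp only [traj]
    rw [blockMove]
    by_cases hd : ((N : ℤ) + 1) ∣ traj (blockMove c N m) T q + T + 1
    · rw [run_block_of_dvd hN hd]
      congr 1
      have hv := h T (by omega) hd
      by_cases hk : c + 1 ≤ m T
      · rw [if_pos hk, if_pos ⟨hd, hk⟩]
        congr 1
        push_cast
        ring
      · rw [if_neg hk, if_neg (fun h => hk h.2)]
        rw [show traj (blockMove c N m) T q + ((T + 1 : ℕ) : ℤ) =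
          traj (blockMove c N m) T q + T + 1 by push_cast; ring, physState, if_pos hd]
        omega
    · rw [run_block_of_not_dvd hN hd, if_neg (fun h => hd h.1)]
      congr 2
      push_cast
      ring

/-- A passing pawn whose block is shorter than c is stranded among N + 1, ..., N + c. Either the
word ends there, away from state 1, or the next a is undefined. -/
theorem isValidBlock_of_run_eq_one (hN : 1 ≤ N) {q T : ℕ} (hq : 1 ≤ q) (hqN : q ≤ N)
    (h : (cernyPFA c (N + c + 1)).run q (blockWord m T) = some 1) :
    IsValidBlock c N m T q := by
  intro t
  induction t using Nat.strong_induction_on with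
  | _ t ih =>
    intro ht hd
    by_contra hcon
    have h1 := run_blockWord (m := m) (T := t) hN hq hqN fun s hs hd' => ih s hs (by omega) hd'
    have h2 : (cernyPFA c (N + c + 1)).run q (blockWord m (t + 1)) = some (N + 1 + m t) := by
      rw [blockWord, PFA.run_append, h1, Option.bind_some, run_block_of_dvd hN hd,
        if_neg (by omega)]
    rcases Nat.eq_or_lt_of_le (show t + 1 ≤ T from ht) with rfl | hlt
    · rw [h2, Option.some_inj] at h
      omega
    · obtain ⟨v, hv⟩ := blockWord_eq_append m (t + 1) (T - t - 2)
      rw [show t + 1 + (T - t - 2) + 1 = T by omega] at hv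
      rw [hv, PFA.run_append, h2, Option.bind_some, PFA.run_cons,
        step_a_mid (by omega) (by omega)] at h
      simp at h

/-- A shortest synchronizing word sends everything to the state `1`. -/
theorem run_eq_one_of_isShortest (hN : 1 ≤ N) {v : List Letter}
    (hv : (cernyPFA c (N + c + 1)).IsShortest {q | 1 ≤ q ∧ q ≤ N} v) :
    ∀ q, 1 ≤ q → q ≤ N → (cernyPFA c (N + c + 1)).run q v = some 1 := by
  obtain ⟨⟨s, hs⟩, hmin⟩ := hv
  suffices h1 : s = 1 from fun q h h' => h1 ▸ hs q ⟨h, h'⟩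
  rcases List.eq_nil_or_concat v with rfl | ⟨w, x, rfl⟩
  · have := hs 1 ⟨le_rfl, hN⟩
    rw [PFA.run_nil, Option.some_inj] at this
    exact this.symm
  · have hnot : ¬ (cernyPFA c (N + c + 1)).Syncs {q | 1 ≤ q ∧ q ≤ N} w := fun h => by
      have := hmin w h
      simp at this
    have key : ∀ q, 1 ≤ q ∧ q ≤ N → ∃ r, (cernyPFA c (N + c + 1)).run q w = some r ∧
        (cernyPFA c (N + c + 1)).step r x = some s ∧ 1 ≤ r ∧ r ≤ N + c + 1 := by
      intro q hq
      have h1 := hs q hq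
      rw [List.concat_eq_append, PFA.run_append, Option.bind_eq_some_iff] at h1
      obtain ⟨r, hr, h2⟩ := h1
      have h3 : (cernyPFA c (N + c + 1)).step r x = some s := by
        rw [PFA.run_cons, Option.bind_eq_some_iff] at h2
        obtain ⟨p, hp, h4⟩ := h2
        rw [PFA.run_nil, Option.some_inj] at h4
        rw [hp, h4]
      refine ⟨r, hr, h3, ?_⟩
      have hmem : ∀ (w : List Letter) (q s : ℕ), 1 ≤ q ∧ q ≤ N + c + 1 →
          (cernyPFA c (N + c + 1)).run q w = some s → 1 ≤ s ∧ s ≤ N + c + 1 := by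
        intro w
        induction w with
        | nil =>
          intro q s hq h
          rw [PFA.run_nil, Option.some_inj] at h
          exact h ▸ hq
        | cons x w ih =>
          intro q s hq h
          rw [PFA.run_cons, Option.bind_eq_some_iff] at h
          obtain ⟨r, hr, h⟩ := h
          exact ih r s (Finset.mem_Icc.1
            (PFA.step_mem _ q (Finset.mem_Icc.2 hq) x r hr)) h
      exact hmem w q r (by omega) hr
    obtain ⟨r, hr, hrs, hr1, hr2⟩ := key 1 ⟨le_rfl, hN⟩
    obtain ⟨q, hq, hqr⟩ : ∃ q, (1 ≤ q ∧ q ≤ N) ∧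
        (cernyPFA c (N + c + 1)).run q w ≠ some r := by
      by_contra hcon
      push Not at hcon
      exact hnot ⟨r, hcon⟩
    obtain ⟨p, hp, hps, hp1, hp2⟩ := key q hq
    have hne : p ≠ r := by
      rintro rfl
      exact hqr hp
    -- By minimality the last letter identifies two distinct states. Only b does so, for 1 and N + c
    -- + 1, and the common image is 1.
    have cases3 : ∀ r, 1 ≤ r → r ≤ N + c + 1 → r ≤ N ∨ (N < r ∧ r ≤ N + c) ∨ r = N + c + 1 := by
      omega
    cases x with
    | a =>
      rcases cases3 r hr1 hr2 with h | ⟨h, h'⟩ | rfl <;>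
      rcases cases3 p hp1 hp2 with h2 | ⟨h2, h2'⟩ | rfl
      all_goals first
        | (rw [step_a_mid h h'] at hrs; simp at hrs)
        | (rw [step_a_mid h2 h2'] at hps; simp at hps)
        | skip
      · rw [step_a_low h, Option.some_inj] at hrs
        rw [step_a_low h2, Option.some_inj] at hps
        omega
      · rw [step_a_top, Option.some_inj] at hps
        exact hps.symm
      · rw [step_a_top, Option.some_inj] at hrs
        exact hrs.symm
      · exact absurd rfl hne
    | b =>
      rcases cases3 r hr1 hr2 with h | ⟨h, h'⟩ | rfl
      · rw [step_b_low h, Option.some_inj] at hrs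
        rcases cases3 p hp1 hp2 with h2 | ⟨h2, h2'⟩ | rfl
        · rw [step_b_low h2, Option.some_inj] at hps
          omega
        · rw [step_b_mid h2 h2', Option.some_inj] at hps
          omega
        · rw [step_b_top, Option.some_inj] at hps
          exact hps.symm
      · rw [step_b_mid h h', Option.some_inj] at hrs
        rcases cases3 p hp1 hp2 with h2 | ⟨h2, h2'⟩ | rfl
        · rw [step_b_low h2, Option.some_inj] at hps
          omega
        · rw [step_b_mid h2 h2', Option.some_inj] at hps
          omega
        · rw [step_b_top, Option.some_inj] at hps
          exact hps.symm
      · rw [step_b_top, Option.some_inj] at hrs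
        exact hrs.symm

/-- A shortest word consists of blocks. -/
theorem exists_blockWord_of_isShortest (hN : 1 ≤ N) {v : List Letter}
    (hv : (cernyPFA c (N + c + 1)).IsShortest {q | 1 ≤ q ∧ q ≤ N} v) :
    ∃ m T, v = blockWord m T ∧ ∀ q : ℕ, 1 ≤ q → q ≤ N → IsValidBlock c N m T q ∧
      (traj (blockMove c N m) T q + T) % ((N : ℤ) + 1) = 1 := by
  have hb : ∀ w, v ≠ .b :: w := by
    rintro w rfl
    have := hv.2 w (hv.1.of_cons fun r hr => ⟨r, hr, step_b_low hr.2⟩)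
    simp at this
  obtain ⟨m, T, rfl⟩ := exists_blockWord v hb
  refine ⟨m, T, rfl, fun q h1 h2 => ?_⟩
  have h3 := run_eq_one_of_isShortest hN hv q h1 h2
  have h4 := isValidBlock_of_run_eq_one hN h1 h2 h3
  refine ⟨h4, ?_⟩
  rw [run_blockWord hN h1 h2 h4, Option.some_inj] at h3
  rcases physState_spec (c := c) (N := N) (traj (blockMove c N m) T q + T) with
    ⟨-, h⟩ | ⟨-, -, -, h⟩ <;> omega

end Block

end BlockWord

/-! ### Lower bounds for the numbers of letters a and b -/

section BlockLowerBound

variable {c : ℕ}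
section BlockBound

variable {N : ℕ} {m : ℕ → ℕ}

theorem blockVisits_of_eq {t : ℕ} {y k r : ℤ} (h : y + t = ((N : ℤ) + 1) * k + r)
    (h0 : 0 ≤ r) (h1 : r < (N : ℤ) + 1) : blockVisits N t y = k := by
  rw [blockVisits, h, Int.mul_add_ediv_left _ _ (by omega), Int.ediv_eq_zero_of_lt h0 h1, add_zero]

/-- The quotient of y + t by N + 1 grows exactly at a passage; a move lands on residue 1 instead of
0, with the same quotient. -/
theorem blockMove_cases (hN : 1 ≤ N) (t : ℕ) (y : ℤ) :
    (¬ ((N : ℤ) + 1) ∣ y + t + 1 ∧ blockMove c N m t y = y ∧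
      blockVisits N (t + 1) y = blockVisits N t y) ∨
    (((N : ℤ) + 1) ∣ y + t + 1 ∧ m t ≤ c ∧ blockMove c N m t y = y ∧
      blockVisits N (t + 1) y = blockVisits N t y + 1) ∨
    (((N : ℤ) + 1) ∣ y + t + 1 ∧ c + 1 ≤ m t ∧ blockMove c N m t y = y + 1 ∧
      blockVisits N (t + 1) (y + 1) = blockVisits N t y + 1) := by
  by_cases h : ((N : ℤ) + 1) ∣ y + t + 1
  · obtain ⟨k, hk⟩ := id h
    have h1 : blockVisits N t y = k - 1 :=
      blockVisits_of_eq (r := N) (by linarith) (by omega) (by omega)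
    by_cases hm : c + 1 ≤ m t
    · refine Or.inr (Or.inr ⟨h, hm, if_pos ⟨h, hm⟩, ?_⟩)
      rw [h1, blockVisits_of_eq (k := k) (r := 1) (by push_cast; linarith) (by omega) (by omega)]
      ring
    · refine Or.inr (Or.inl ⟨h, by omega, if_neg fun h' => hm h'.2, ?_⟩)
      rw [h1, blockVisits_of_eq (k := k) (r := 0) (by push_cast; linarith) (by omega) (by omega)]
      ring
  · refine Or.inl ⟨h, if_neg fun h' => h h'.1, ?_⟩
    have h1 := Int.emod_add_mul_ediv (y + t) ((N : ℤ) + 1)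
    have h2 := Int.emod_nonneg (y + t) (show (N : ℤ) + 1 ≠ 0 by omega)
    have h3 := Int.emod_lt_of_pos (y + t) (show 0 < (N : ℤ) + 1 by omega)
    have h4 : (y + t) % ((N : ℤ) + 1) ≠ N := by
      intro h5
      exact h ⟨(y + t) / ((N : ℤ) + 1) + 1, by rw [h5] at h1; linarith⟩
    rw [blockVisits_of_eq (t := t + 1) (k := (y + t) / ((N : ℤ) + 1))
      (r := (y + t) % ((N : ℤ) + 1) + 1) (by push_cast; linarith) (by omega) (by omega)]
    rfl

theorem isPawnSystem_block (hN : 1 ≤ N) : IsPawnSystem (blockMove c N m) (blockVisits N) where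
  step t y := by unfold blockMove; split_ifs <;> simp
  visit t y := by
    rcases blockMove_cases (c := c) (m := m) hN t y with ⟨-, h, h'⟩ | ⟨-, -, h, h'⟩ | ⟨-, -, h, h'⟩
    all_goals
      rw [h, h']
      omega
  mono _ _ h := Int.ediv_le_ediv (by omega) (by simpa using h)

theorem traj_block_add (t : ℕ) (y : ℤ) :
    traj (blockMove c N m) t (y + (N + 1)) = traj (blockMove c N m) t y + (N + 1) := by
  induction t with
  | zero => rfl
  | succ t ih =>
    simp only [traj, ih]
    have h : ((N : ℤ) + 1) ∣ traj (blockMove c N m) t y + (N + 1) + t + 1 ↔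
        ((N : ℤ) + 1) ∣ traj (blockMove c N m) t y + t + 1 := by
      rw [show traj (blockMove c N m) t y + (N + 1) + t + 1 =
        traj (blockMove c N m) t y + t + 1 + (N + 1) by ring]
      exact dvd_add_self_right
    simp only [blockMove, h]
    split_ifs <;> ring

theorem IsValidBlock.add {T : ℕ} {y : ℤ} (h : IsValidBlock c N m T y) :
    IsValidBlock c N m T (y + (N + 1)) := by
  intro t ht hd
  rw [traj_block_add, show traj (blockMove c N m) t y + (N + 1) + t + 1 =
    traj (blockMove c N m) t y + t + 1 + (N + 1) by ring] at hd
  exact h t ht (dvd_add_self_right.1 hd)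

/-- Pawns which are passing at the same time have merged, if they merge without a detour. -/
theorem traj_eq_of_dvd (hN : 1 ≤ N) {T t : ℕ} {p q : ℤ} (ht : t ≤ T) (hpq : p ≤ q)
    (hqp : q ≤ p + (N + 1)) (hT : traj (blockMove c N m) T p = traj (blockMove c N m) T q)
    (hp : ((N : ℤ) + 1) ∣ traj (blockMove c N m) t p + t + 1)
    (hq : ((N : ℤ) + 1) ∣ traj (blockMove c N m) t q + t + 1) :
    traj (blockMove c N m) t p = traj (blockMove c N m) t q := by
  have h1 := (isPawnSystem_block (c := c) (m := m) hN).traj_mono t hpq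
  have h2 := (isPawnSystem_block (c := c) (m := m) hN).traj_mono t hqp
  obtain ⟨k, hk⟩ := dvd_sub hq hp
  have e : traj (blockMove c N m) t q = traj (blockMove c N m) t p + (N + 1) * k := by linarith
  rw [e, traj_block_add] at h2
  rw [e] at h1
  have hk0 : 0 ≤ k := by
    by_contra hcon
    have : ((N : ℤ) + 1) * k < 0 := mul_neg_of_pos_of_neg (by omega) (by omega)
    omega
  have hk1 : k ≤ 1 := by
    by_contra hcon
    have : ((N : ℤ) + 1) * 2 ≤ (N + 1) * k := mul_le_mul_of_nonneg_left (by omega) (by omega)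
    omega
  rcases (show k = 0 ∨ k = 1 by omega) with rfl | rfl
  · rw [e]; ring
  -- Here q has caught up with the copy of p one full turn ahead, so they stay together, contrary to
  -- p and q ending at the same position.
  · exfalso
    rw [mul_one, ← traj_block_add] at e
    have h3 := traj_eq_of_le ht e
    rw [traj_block_add, ← hT] at h3
    omega

/-- By `traj_eq_of_dvd` at most one occupied position passes during a block. It costs c, available
by validity, or c + 1 when it moves, which requires a block that long; all other positions cost
nothing. -/
theorem sum_stepCost_le (hN : 1 ≤ N) {P : Finset ℤ} {T t : ℕ} {z : ℤ} (ht : t < T)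
    (hP : ∀ p ∈ P, ∀ q ∈ P, q ≤ p + (N + 1)) (hv : ∀ p ∈ P, IsValidBlock c N m T p)
    (hz : ∀ p ∈ P, traj (blockMove c N m) T p = z) :
    ∑ y ∈ P.image (traj (blockMove c N m) t),
      stepCost c (blockMove c N m) (blockVisits N) t y ≤ m t := by
  have hzero : ∀ y, ¬ ((N : ℤ) + 1) ∣ y + t + 1 →
      stepCost c (blockMove c N m) (blockVisits N) t y = 0 := by
    intro y hy
    rcases blockMove_cases (c := c) (m := m) hN t y with ⟨-, h, h'⟩ | ⟨h, -⟩ | ⟨h, -⟩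
    · rw [stepCost, h, h']; ring
    · exact absurd h hy
    · exact absurd h hy
  by_cases hex : ∃ p ∈ P, ((N : ℤ) + 1) ∣ traj (blockMove c N m) t p + t + 1
  · obtain ⟨p, hp, hd⟩ := hex
    rw [Finset.sum_eq_single_of_mem _ (Finset.mem_image_of_mem _ hp)]
    · have hm := hv p hp t ht hd
      rcases blockMove_cases (c := c) (m := m) hN t (traj (blockMove c N m) t p) with
        ⟨h, -⟩ | ⟨-, -, h, h'⟩ | ⟨-, hc, h, h'⟩
      · exact absurd hd h
      · rw [stepCost, h, h']
        ring_nf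
        exact_mod_cast hm
      · rw [stepCost, h, h']
        ring_nf
        exact_mod_cast (by omega : 1 + c ≤ m t)
    · intro y hy hne
      obtain ⟨q, hq, rfl⟩ := Finset.mem_image.1 hy
      refine hzero _ fun hd' => hne ?_
      have hT := (hz p hp).trans (hz q hq).symm
      rcases le_total p q with h | h
      · exact (traj_eq_of_dvd hN ht.le h (hP p hp q hq) hT hd hd').symm
      · exact traj_eq_of_dvd hN ht.le h (hP q hq p hp) hT.symm hd' hd
  · rw [Finset.sum_eq_zero]
    · positivity
    · intro y hy
      obtain ⟨q, hq, rfl⟩ := Finset.mem_image.1 hy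
      exact hzero _ fun hd => hex ⟨q, hq, hd⟩

theorem groupCost_block_le (hN : 1 ≤ N) {P : Finset ℤ} {T : ℕ} {z : ℤ}
    (hP : ∀ p ∈ P, ∀ q ∈ P, q ≤ p + (N + 1)) (hv : ∀ p ∈ P, IsValidBlock c N m T p)
    (hz : ∀ p ∈ P, traj (blockMove c N m) T p = z) :
    groupCost c (blockMove c N m) (blockVisits N) P T ≤ ∑ t ∈ Finset.range T, m t := by
  push_cast
  exact Finset.sum_le_sum fun t ht => sum_stepCost_le hN (Finset.mem_range.1 ht) hP hv hz

/-- A pawn moves at most once per passage, and passages occur only when y + t + 1 is a multiple of N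
+ 1. This speed limit bounds the number of letters a. -/
theorem traj_block_time (hN : 1 ≤ N) {u : ℤ} (hu : 1 ≤ u) (t : ℕ) :
    ((N : ℤ) + 1) * (traj (blockMove c N m) t u - u) + 1 ≤ traj (blockMove c N m) t u + t := by
  induction t with
  | zero => simp only [traj]; push_cast; linarith
  | succ t ih =>
    simp only [traj]
    set y := traj (blockMove c N m) t u
    rcases blockMove_cases (c := c) (m := m) hN t y with
      ⟨-, h, -⟩ | ⟨-, -, h, -⟩ | ⟨hd, -, h, -⟩
    · rw [h]; push_cast; linarith
    · rw [h]; push_cast; linarith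
    · obtain ⟨k, hk⟩ := hd
      have h1 : ((N : ℤ) + 1) * (y - u) < (N + 1) * k := by linarith
      have h2 : y - u + 1 ≤ k := lt_of_mul_lt_mul_left h1 (by omega)
      have h3 : ((N : ℤ) + 1) * (y - u + 1) ≤ (N + 1) * k :=
        mul_le_mul_of_nonneg_left h2 (by omega)
      rw [h]
      push_cast
      linarith

/-- The pawns on `i + 1, ..., N` and the pawns on `1, ..., i` with a delay of one round. -/
noncomputable def cutPawns (N i : ℕ) : Finset ℤ :=
  (Finset.Icc ((i : ℤ) + 1) (i + (N + 1))).erase (N + 1)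

theorem mem_cutPawns {i : ℕ} {p : ℤ} :
    p ∈ cutPawns N i ↔ p ≠ N + 1 ∧ (i : ℤ) + 1 ≤ p ∧ p ≤ i + (N + 1) := by
  rw [cutPawns, Finset.mem_erase, Finset.mem_Icc]

theorem card_cutPawns {i : ℕ} (hi : i ≤ N) : (cutPawns N i).card = N := by
  rw [cutPawns, Finset.card_erase_of_mem (Finset.mem_Icc.2 (by omega)), Int.card_Icc]
  omega

/-- The visit counter jumps by one at N + 1, and the missing pawn at N + 1 compensates exactly for
the jump. -/
theorem isSpread_cutPawns {i : ℕ} (hi : i < N) : IsSpread (blockVisits N) (cutPawns N i) := by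
  intro u hu v hv huv
  rw [mem_cutPawns] at hu hv
  have h1 : ((cutPawns N i).filter fun p => u ≤ p ∧ p ≤ v) ⊆ (Finset.Icc u v).erase (N + 1) := by
    intro p hp
    rw [Finset.mem_filter, mem_cutPawns] at hp
    exact Finset.mem_erase.2 ⟨hp.1.1, Finset.mem_Icc.2 hp.2⟩
  have h2 := Finset.card_le_card h1
  have low : ∀ {p : ℤ}, (i : ℤ) + 1 ≤ p → p < N + 1 → blockVisits N 0 p = 0 := fun h h' =>
    blockVisits_of_eq (k := 0) (r := _) (by push_cast; ring_nf) (by omega) (by omega)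
  have high : ∀ {p : ℤ}, (N : ℤ) + 1 ≤ p → p ≤ i + (N + 1) → blockVisits N 0 p = 1 :=
    fun {p} h h' => blockVisits_of_eq (k := 1) (r := p - (N + 1)) (by push_cast; ring)
      (by omega) (by omega)
  rcases lt_or_ge u ((N : ℤ) + 1) with h3 | h3
  · rcases lt_or_ge v ((N : ℤ) + 1) with h4 | h4
    · rw [low hu.2.1 h3, low hv.2.1 h4]
      have := h2.trans (Finset.card_erase_le)
      rw [Int.card_Icc] at this
      omega
    · rw [low hu.2.1 h3, high h4 hv.2.2]
      rw [Finset.card_erase_of_mem (Finset.mem_Icc.2 ⟨h3.le, h4⟩), Int.card_Icc] at h2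
      omega
  · rw [high h3 hu.2.2, high (h3.trans huv) hv.2.2]
    have := h2.trans (Finset.card_erase_le)
    rw [Int.card_Icc] at this
    omega

/-- The number of letters b dominates the cost of the pawn system, to which `groupBound_le` applies.
The visits and moves in `groupBound` beyond the minimum only increase the bound. -/
theorem minCost_le_of_cut (hc : 1 ≤ c) (hN : 1 ≤ N) {T i : ℕ} (hi : i < N) {z : ℤ}
    (hv : ∀ q : ℕ, 1 ≤ q → q ≤ N → IsValidBlock c N m T q)
    (hz : ∀ p ∈ cutPawns N i, traj (blockMove c N m) T p = z) :
    minCost c N ≤ ∑ t ∈ Finset.range T, m t := by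
  have hsys := isPawnSystem_block (c := c) (m := m) hN
  have hvalid : ∀ p ∈ cutPawns N i, IsValidBlock c N m T p := by
    intro p hp
    rw [mem_cutPawns] at hp
    rcases lt_or_ge p ((N : ℤ) + 1) with h | h
    · have := hv p.toNat (by omega) (by omega)
      rwa [Int.toNat_of_nonneg (by omega)] at this
    · have := (hv (p - (N + 1)).toNat (by omega) (by omega)).add
      rwa [Int.toNat_of_nonneg (by omega), sub_add_cancel] at this
  have h1 := groupCost_block_le hN (fun p hp q hq => by
    rw [mem_cutPawns] at hp hq; omega) hvalid hz
  have hu : (i : ℤ) + 1 ∈ cutPawns N i := mem_cutPawns.2 (by omega)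
  have hV0 : blockVisits N 0 ((i : ℤ) + 1) = 0 :=
    blockVisits_of_eq (k := 0) (r := i + 1) (by push_cast; ring) (by omega) (by omega)
  have h2 := hsys.visit_traj ((i : ℤ) + 1) T
  rw [hz _ hu, hV0] at h2
  have key : ∀ v ∈ cutPawns N i, (∀ p ∈ cutPawns N i, p ≤ v) →
      (N : ℤ) - 1 + blockVisits N 0 v ≤ v - (i + 1) → minCost c N ≤ ∑ t ∈ Finset.range T, m t := by
    intro v hvP hmax hV
    have h3 := hsys.groupBound_le hc (isSpread_cutPawns hi) hz hvP hmax
    have h4 := hsys.traj_le_traj v (Nat.zero_le T)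
    rw [hz v hvP] at h4
    simp only [traj] at h4
    rw [groupBound, card_cutPawns hi.le] at h3
    have h5 : 0 ≤ (c : ℤ) * (blockVisits N T z - blockVisits N 0 v - (N - 1)) :=
      mul_nonneg (by positivity) (by linarith)
    zify
    push_cast at h1
    linarith
  rcases Nat.eq_zero_or_pos i with rfl | hi0
  · refine key N (mem_cutPawns.2 (by omega)) (fun p hp => ?_) ?_
    · rw [mem_cutPawns] at hp
      push_cast at hp
      omega
    · rw [blockVisits_of_eq (k := 0) (r := N) (by push_cast; ring) (by omega) (by omega)]
      push_cast
      omega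
  · refine key (i + (N + 1)) (mem_cutPawns.2 (by omega)) (fun p hp => (mem_cutPawns.1 hp).2.2) ?_
    rw [blockVisits_of_eq (k := 1) (r := i) (by push_cast; ring) (by omega) (by omega)]
    omega

/-- The final positions are congruent modulo N + 1; by monotonicity and periodicity each is z or z +
(N + 1). So the pawns merge after cutting the circle at some i, and i = 0 is the ordinary race. -/
theorem blockWord_lower_bound (hc : 1 ≤ c) (hN : 1 ≤ N) {T : ℕ}
    (h : ∀ q : ℕ, 1 ≤ q → q ≤ N → IsValidBlock c N m T q ∧
      (traj (blockMove c N m) T q + T) % ((N : ℤ) + 1) = 1) :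
    N * (N - 1) ≤ T ∧ minCost c N ≤ ∑ t ∈ Finset.range T, m t ∧
      (T = N * (N - 1) → ∀ q ∈ block 0 N, traj (blockMove c N m) T q = N) := by
  have hsys := isPawnSystem_block (c := c) (m := m) hN
  have hv := fun q h1 h2 => (h q h1 h2).1
  have hge : ∀ y, y ≤ traj (blockMove c N m) T y := fun y => hsys.traj_le_traj y (Nat.zero_le T)
  set z := traj (blockMove c N m) T 1 with hz
  have htime := fun (u : ℤ) (hu : 1 ≤ u) => traj_block_time (c := c) (m := m) hN hu T
  have hcong : ∀ q : ℕ, 1 ≤ q → q ≤ N → traj (blockMove c N m) T q = z ∨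
      traj (blockMove c N m) T q = z + (N + 1) := by
    intro q h1 h2
    have e1 := (h q h1 h2).2
    have e2 := (h 1 le_rfl hN).2
    rw [Nat.cast_one, ← hz] at e2
    obtain ⟨k, hk⟩ : ((N : ℤ) + 1) ∣ traj (blockMove c N m) T q - z := by
      have h3 : z + T ≡ traj (blockMove c N m) T q + T [ZMOD ((N : ℤ) + 1)] := e2.trans e1.symm
      have h4 := h3.dvd
      rwa [add_sub_add_right_eq_sub] at h4
    have m1 := hsys.traj_mono T (show (1 : ℤ) ≤ q by omega)
    have m2 := hsys.traj_mono T (show (q : ℤ) ≤ 1 + (N + 1) by omega)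
    rw [traj_block_add] at m2
    have hk0 : 0 ≤ k := by
      by_contra hcon
      have : ((N : ℤ) + 1) * k < 0 := mul_neg_of_pos_of_neg (by omega) (by omega)
      omega
    have hk1 : k ≤ 1 := by
      by_contra hcon
      have : ((N : ℤ) + 1) * 2 ≤ (N + 1) * k := mul_le_mul_of_nonneg_left (by omega) (by omega)
      omega
    rcases (show k = 0 ∨ k = 1 by omega) with rfl | rfl
    · left; linarith
    · right; linarith
  by_cases hall : ∀ q : ℕ, 1 ≤ q → q ≤ N → traj (blockMove c N m) T q = z
  · -- all pawns merge without a cut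
    have hz' : ∀ p : ℤ, 1 ≤ p → p ≤ N → traj (blockMove c N m) T p = z := by
      intro p h1 h2
      have := hall p.toNat (by omega) (by omega)
      rwa [Int.toNat_of_nonneg (by omega)] at this
    have hzN : (N : ℤ) ≤ z := by
      rw [← hz' N (by omega) le_rfl]
      exact hge N
    have ht := htime 1 le_rfl
    rw [← hz] at ht
    have hT : (N : ℤ) * (z - 1) ≤ T := by linarith
    have hN1 : ((N * (N - 1) : ℕ) : ℤ) = N * (N - 1) := by push_cast [hN]; ring
    have hT' : (N : ℤ) * (N - 1) ≤ N * (z - 1) := mul_le_mul_of_nonneg_left (by omega) (by omega)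
    refine ⟨Int.ofNat_le.1 (by rw [hN1]; linarith), ?_, fun hTeq q hq => ?_⟩
    · refine minCost_le_of_cut hc hN (i := 0) (z := z) hN hv fun p hp => ?_
      rw [mem_cutPawns] at hp
      push_cast at hp
      exact hz' p (by omega) (by omega)
    · rw [Finset.mem_Icc] at hq
      rw [hz' q (by omega) (by omega)]
      have h1 : (N : ℤ) * (z - 1) ≤ N * (N - 1) := by
        rw [← hN1, ← hTeq]
        exact hT
      have := le_of_mul_le_mul_left h1 (by omega)
      omega
  · -- the pawns merge around the circle
    push Not at hall
    have hex : ∃ q : ℕ, 1 ≤ q ∧ q ≤ N ∧ traj (blockMove c N m) T q ≠ z := hall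
    obtain ⟨j, ⟨hj1, hjN, hjz⟩, hmin⟩ : ∃ j : ℕ, (1 ≤ j ∧ j ≤ N ∧ traj (blockMove c N m) T j ≠ z) ∧
        ∀ k < j, ¬ (1 ≤ k ∧ k ≤ N ∧ traj (blockMove c N m) T k ≠ z) :=
      ⟨Nat.find hex, Nat.find_spec hex, fun k hk => Nat.find_min hex hk⟩
    obtain ⟨i, rfl⟩ : ∃ i, j = i + 1 := ⟨j - 1, by omega⟩
    have hi0 : 1 ≤ i := by
      by_contra hcon
      obtain rfl : i = 0 := by omega
      exact hjz (by simp [hz])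
    have hju := (hcong (i + 1) hj1 hjN).resolve_left hjz
    have hcut : ∀ p ∈ cutPawns N i, traj (blockMove c N m) T p = z + (N + 1) := by
      intro p hp
      rw [mem_cutPawns] at hp
      rcases lt_or_ge p ((N : ℤ) + 1) with h1 | h1
      · have e1 := hcong p.toNat (by omega) (by omega)
        rw [Int.toNat_of_nonneg (by omega)] at e1
        have e2 := hsys.traj_mono T (show ((i + 1 : ℕ) : ℤ) ≤ p by push_cast; omega)
        omega
      · have e1 := hmin (p - (N + 1)).toNat (by omega)
        push Not at e1
        have e2 := e1 (by omega) (by omega)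
        rw [Int.toNat_of_nonneg (by omega)] at e2
        rw [← e2, ← traj_block_add, sub_add_cancel]
    have ht := htime ((i + 1 : ℕ) : ℤ) (by push_cast; omega)
    have hlast := hge (i + (N + 1))
    rw [hcut _ (mem_cutPawns.2 (by omega))] at hlast
    rw [hju] at ht
    have h1 : (N : ℤ) * (i + (N + 1)) ≤ N * (z + (N + 1)) :=
      mul_le_mul_of_nonneg_left hlast (by omega)
    push_cast at ht
    have hN1 : ((N * (N - 1) : ℕ) : ℤ) = N * (N - 1) := by push_cast [hN]; ring
    -- The speed limit for the pawn i + 1 gives T ≥ N² - i, and i < N: a cut inside the circle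
    -- wastes letters a.
    have hlt : N * (N - 1) < T := by
      apply Int.ofNat_lt.1
      rw [hN1]
      have : (i : ℤ) + 1 ≤ N := by omega
      nlinarith
    exact ⟨hlt.le, minCost_le_of_cut hc hN (by omega) hv hcut, fun hTeq => by omega⟩

end BlockBound

end BlockLowerBound

/-! ### Optimal races correspond to shortest words -/

section WordOfRace

variable {c : ℕ}
section RaceWord

variable {N : ℕ} {M : ℕ → Finset ℤ} {m : ℕ → ℕ}

/-- The lengths of the `b`-blocks in the word that belongs to a race. -/
noncomputable def raceWord (c N : ℕ) (M : ℕ → Finset ℤ) (t : ℕ) : ℕ :=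
  if (N : ℤ) - (t % (N + 1) : ℕ) ∈ (block 0 N).image (traj (raceMove M) (t / (N + 1))) then
    c + if (N : ℤ) - (t % (N + 1) : ℕ) ∈ M (t / (N + 1)) then 1 else 0
  else 0

theorem visit_div {t r : ℕ} {y : ℤ} (h : y + t + 1 = ((N : ℤ) + 1) * (r + 1)) (h0 : 0 ≤ y)
    (h1 : y ≤ N) : t / (N + 1) = r ∧ (N : ℤ) - (t % (N + 1) : ℕ) = y := by
  obtain ⟨d, hd⟩ : ∃ d : ℕ, (N : ℤ) - y = d := ⟨(N - y).toNat, by omega⟩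
  have ht : t = (N + 1) * r + d := by
    zify
    linarith
  rw [ht, Nat.mul_add_div (by omega), Nat.mul_add_mod, Nat.div_eq_of_lt (by omega),
    Nat.mod_eq_of_lt (by omega)]
  omega

theorem div_visit (t : ℕ) :
    (N : ℤ) - (t % (N + 1) : ℕ) + t + 1 = ((N : ℤ) + 1) * ((t / (N + 1) : ℕ) + 1) := by
  have h : ((N + 1) * (t / (N + 1)) + t % (N + 1) : ℕ) = t := Nat.div_add_mod t (N + 1)
  zify at h
  push_cast
  linarith

theorem raceWord_of_mem {t r : ℕ} {y : ℤ} (h : y + t + 1 = ((N : ℤ) + 1) * (r + 1)) (h0 : 0 ≤ y)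
    (h1 : y ≤ N) (hy : y ∈ (block 0 N).image (traj (raceMove M) r)) :
    raceWord c N M t = c + if y ∈ M r then 1 else 0 := by
  obtain ⟨e1, e2⟩ := visit_div h h0 h1
  rw [raceWord, e1, e2, if_pos hy]

/-- `Follows c N M m T`: the blocks before time `T` make the pawns of the race `M` move exactly
when they move in the race. -/
def Follows (c N : ℕ) (M : ℕ → Finset ℤ) (m : ℕ → ℕ) (T : ℕ) : Prop :=
  ∀ r t, t < T → ∀ q ∈ block 0 N,
    traj (raceMove M) r q + t + 1 = ((N : ℤ) + 1) * (r + 1) →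
      (c + 1 ≤ m t ↔ traj (raceMove M) r q ∈ M r)

/-- Here r is the number of race iterations the pawn has completed. The displacement of the last
iteration sharpens the lower bound: right after a move the residue is at least 1. For r = 0 the
truncated r - 1 makes this term zero. -/
theorem Follows.exists_round (hN : 1 ≤ N) {T : ℕ} (H : Follows c N M m T) {q : ℤ}
    (hq : q ∈ block 0 N) {t : ℕ} (ht : t ≤ T) :
    ∃ r : ℕ, traj (blockMove c N m) t q = traj (raceMove M) r q ∧
      ((N : ℤ) + 1) * r + (traj (raceMove M) r q - traj (raceMove M) (r - 1) q) ≤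
        traj (raceMove M) r q + t ∧
      traj (raceMove M) r q + t < ((N : ℤ) + 1) * (r + 1) := by
  induction t with
  | zero =>
    rw [Finset.mem_Icc] at hq
    refine ⟨0, rfl, ?_, ?_⟩
    · change ((N : ℤ) + 1) * (0 : ℕ) + (q - q) ≤ q + (0 : ℕ)
      push_cast
      omega
    · change q + (0 : ℕ) < ((N : ℤ) + 1) * ((0 : ℕ) + 1)
      push_cast
      linarith
  | succ t ih =>
    obtain ⟨r, h1, h2, h3⟩ := ih (by omega)
    set y := traj (raceMove M) r q with hy
    rcases (Int.add_one_le_iff.2 h3).eq_or_lt with h4 | h4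
    · have hd : ((N : ℤ) + 1) ∣ y + t + 1 := ⟨_, h4⟩
      have hiff := H r t (by omega) q hq h4
      have hmove : traj (blockMove c N m) (t + 1) q = traj (raceMove M) (r + 1) q := by
        rw [← hy] at hiff
        simp only [traj, h1, ← hy, blockMove, raceMove, hd, true_and, hiff]
      have hstep := (isPawnSystem_race M).step r y
      refine ⟨r + 1, hmove, ?_, ?_⟩
      · rw [Nat.add_sub_cancel, ← hy]
        push_cast
        linarith
      · simp only [traj, ← hy]
        push_cast
        have : ((N : ℤ) + 1) * (r + 1 + 1) = (N + 1) * (r + 1) + (N + 1) := by ring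
        omega
    · refine ⟨r, ?_, ?_, ?_⟩
      · simp only [traj, h1]
        rw [blockMove, if_neg]
        rintro ⟨⟨k, hk⟩, -⟩
        rw [hk] at h4
        have h5 : k < r + 1 := lt_of_mul_lt_mul_left h4 (by omega)
        have h6 : ((N : ℤ) + 1) * k ≤ (N + 1) * r := mul_le_mul_of_nonneg_left (by omega) (by omega)
        have h7 := (isPawnSystem_race M).traj_le_traj q (Nat.sub_le r 1)
        omega
      · push_cast
        rw [← hy]
        omega
      · push_cast
        rw [← hy]
        omega

/-- Rounds last about N + 1 blocks while the pawn shifts by at most one per round, so the equation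
for t fits only one round. Excluding the very next round uses the displacement term of
`exists_round`. -/
theorem Follows.traj_eq_of_visit (hN : 1 ≤ N) {T : ℕ} (H : Follows c N M m T) {q : ℤ}
    (hq : q ∈ block 0 N) {t r : ℕ} (ht : t ≤ T)
    (h : traj (raceMove M) r q + t + 1 = ((N : ℤ) + 1) * (r + 1)) :
    traj (blockMove c N m) t q = traj (raceMove M) r q := by
  obtain ⟨s, h1, h2, h3⟩ := H.exists_round hN hq ht
  have hsys := isPawnSystem_race M
  suffices e : s = r by rw [h1, e]
  by_contra hne
  rcases lt_or_gt_of_ne hne with hlt | hlt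
  · have h4 := hsys.traj_le_add q hlt.le
    obtain ⟨d, hd⟩ : ∃ d : ℕ, r = s + 1 + d := ⟨r - s - 1, by omega⟩
    subst hd
    push_cast at *
    have e : ((N : ℤ) + 1) * (s + 1 + d + 1) = (N + 1) * (s + 1) + (d + 1) * (N + 1) := by ring
    have e2 : ((d : ℤ) + 1) * 2 ≤ (d + 1) * (N + 1) :=
      mul_le_mul_of_nonneg_left (by omega) (by omega)
    omega
  · have h4 := hsys.traj_le_add q (show r ≤ s - 1 by omega)
    obtain ⟨d, hd⟩ : ∃ d : ℕ, s = r + 1 + d := ⟨s - r - 1, by omega⟩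
    subst hd
    rw [show r + 1 + d - 1 = r + d by omega] at h2 h4
    push_cast at *
    have e : ((N : ℤ) + 1) * (r + 1 + d) = (N + 1) * (r + 1) + d * (N + 1) := by ring
    have e2 : (d : ℤ) * 1 ≤ d * (N + 1) :=
      mul_le_mul_of_nonneg_left (by omega) (by omega)
    omega

theorem visit_lt {t r : ℕ} {y : ℤ} (h : y + t + 1 = ((N : ℤ) + 1) * (r + 1)) (hr : r < N - 1)
    (hy : (r : ℤ) + 1 ≤ y) : t < N * (N - 1) := by
  have h1 : N * (r + 1) ≤ N * (N - 1) := Nat.mul_le_mul_left N (by omega)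
  have h2 : (t : ℤ) < (N * (r + 1) : ℕ) := by
    push_cast
    linarith
  omega

/-- Division by N + 1 matches a time t with the pair (r, y) such that y + t + 1 = (N + 1)(r + 1).
The nonzero blocks are the visits of occupied positions, and `visit_lt` places all of these before
N(N-1). -/
theorem sum_raceWord (hpos : ∀ r < N - 1, ∀ q ∈ block 0 N,
      (r : ℤ) + 1 ≤ traj (raceMove M) r q ∧ traj (raceMove M) r q ≤ N) :
    (∑ t ∈ Finset.range (N * (N - 1)), raceWord c N M t : ℕ) =
      groupCost c (raceMove M) raceVisits (block 0 N) (N - 1) := by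
  have h1 : groupCost c (raceMove M) raceVisits (block 0 N) (N - 1) =
      (∑ r ∈ Finset.range (N - 1), ∑ y ∈ (block 0 N).image (traj (raceMove M) r),
        (c + if y ∈ M r then 1 else 0) : ℕ) := by
    rw [groupCost]
    push_cast
    refine Finset.sum_congr rfl fun r _ => Finset.sum_congr rfl fun y _ => ?_
    simp only [stepCost, raceVisits, raceMove]
    split_ifs <;> push_cast <;> ring
  rw [h1, Nat.cast_inj, Finset.sum_sigma']
  unfold raceWord
  rw [← Finset.sum_filter]
  have hocc : ∀ r < N - 1, ∀ y ∈ (block 0 N).image (traj (raceMove M) r),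
      (r : ℤ) + 1 ≤ y ∧ y ≤ N := by
    intro r hr y hy
    obtain ⟨q, hq, rfl⟩ := Finset.mem_image.1 hy
    exact hpos r hr q hq
  have htime : ∀ x : (_ : ℕ) × ℤ, x ∈ (Finset.range (N - 1)).sigma
      (fun r => (block 0 N).image (traj (raceMove M) r)) →
      (x.2 + (((N : ℤ) + 1) * (x.1 + 1) - x.2 - 1).toNat + 1 = ((N : ℤ) + 1) * (x.1 + 1)) ∧
      x.1 < N - 1 ∧ (x.1 : ℤ) + 1 ≤ x.2 ∧ x.2 ≤ N := by
    rintro ⟨r, y⟩ hx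
    rw [Finset.mem_sigma, Finset.mem_range] at hx
    have h2 := hocc r hx.1 y hx.2
    refine ⟨?_, hx.1, h2⟩
    have h3 : (N : ℤ) + 1 ≤ (N + 1) * (r + 1) := le_mul_of_one_le_right (by omega) (by omega)
    change y + (((N : ℤ) + 1) * (r + 1) - y - 1).toNat + 1 = _
    dsimp only
    omega
  refine Finset.sum_nbij' (fun t => ⟨t / (N + 1), (N : ℤ) - (t % (N + 1) : ℕ)⟩)
    (fun x => (((N : ℤ) + 1) * (x.1 + 1) - x.2 - 1).toNat) ?_ ?_ ?_ ?_ ?_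
  · intro t ht
    rw [Finset.mem_filter, Finset.mem_range] at ht
    rw [Finset.mem_sigma, Finset.mem_range]
    refine ⟨?_, ht.2⟩
    rw [Nat.div_lt_iff_lt_mul (by omega)]
    calc t < N * (N - 1) := ht.1
      _ ≤ (N - 1) * (N + 1) := by rw [mul_comm]; exact Nat.mul_le_mul_left _ (by omega)
  · intro x hx
    obtain ⟨h2, h3, h4, h5⟩ := htime x hx
    rw [Finset.mem_filter, Finset.mem_range]
    obtain ⟨e1, e2⟩ := visit_div h2 (by omega) h5
    rw [e1, e2]
    exact ⟨visit_lt h2 h3 h4, (Finset.mem_sigma.1 hx).2⟩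
  · intro t _
    have := div_visit (N := N) t
    dsimp only
    omega
  · intro x hx
    obtain ⟨h2, h3, h4, h5⟩ := htime x hx
    obtain ⟨e1, e2⟩ := visit_div h2 (by omega) h5
    rw [e1, e2]
  · intro t _
    rfl

theorem optRaces_pos' (hN : 1 ≤ N) (hM : M ∈ optRaces c 0 N) {q : ℤ} (hq : q ∈ block 0 N)
    (r : ℕ) : (min r (N - 1) : ℕ) + 1 ≤ traj (raceMove M) r q ∧ traj (raceMove M) r q ≤ N := by
  rcases le_total r (N - 1) with h | h
  · have := optRaces_pos hM hq h
    rw [min_eq_left h]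
    omega
  · have h1 : traj (raceMove M) r q = N := by
      induction r, h using Nat.le_induction with
      | base => rw [hM.2.2.1 q hq, zero_add]
      | succ r hr ih =>
        simp only [traj]
        rw [raceMove_of_notMem (by rw [hM.2.1 r hr]; simp), ih]
    rw [h1, min_eq_right h]
    omega

theorem follows_raceWord (hN : 1 ≤ N) (hM : M ∈ optRaces c 0 N) (T : ℕ) :
    Follows c N M (raceWord c N M) T := by
  intro r t _ q hq h
  have hpos := optRaces_pos' hN hM hq r
  rw [raceWord_of_mem h (by omega) hpos.2 (Finset.mem_image_of_mem _ hq)]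
  split_ifs with h1 <;> simp [h1]

theorem syncs_raceWord (hN : 1 ≤ N) (hM : M ∈ optRaces c 0 N) :
    (cernyPFA c (N + c + 1)).Syncs {q | 1 ≤ q ∧ q ≤ N}
      (blockWord (raceWord c N M) (N * (N - 1))) := by
  have H := follows_raceWord hN hM (N * (N - 1))
  refine ⟨physState c N (N + (N * (N - 1) : ℕ)), fun q hq => ?_⟩
  have hqb : (q : ℤ) ∈ block 0 N := by
    have h1 := hq.1
    have h2 := hq.2
    exact Finset.mem_Icc.2 (by omega)
  rw [run_blockWord hN hq.1 hq.2]
  · obtain ⟨r, h1, -, h3⟩ := H.exists_round hN hqb le_rfl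
    have hpos := optRaces_pos' hN hM hqb r
    -- After N(N-1) blocks all N - 1 iterations are complete, since a pawn in an earlier round r
    -- would be at r + 1 or beyond.
    have hr : N - 1 ≤ r := by
      by_contra hcon
      rw [min_eq_left (by omega)] at hpos
      have h4 : ((N * (N - 1) : ℕ) : ℤ) < (N * (r + 1) : ℕ) := by
        push_cast at h3 ⊢
        linarith
      have h5 : N * (r + 1) ≤ N * (N - 1) := Nat.mul_le_mul_left N (by omega)
      omega
    rw [min_eq_right hr] at hpos
    rw [h1, show traj (raceMove M) r q = N by omega]
  · intro t ht hd
    obtain ⟨r, h1, h2, h3⟩ := H.exists_round hN hqb ht.le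
    have hpos := optRaces_pos' hN hM hqb r
    have hprev := (isPawnSystem_race M).traj_le_traj q (Nat.sub_le r 1)
    rw [h1] at hd
    -- The bounds of the round leave only one multiple of N + 1 for a passage.
    have h4 : traj (raceMove M) r q + t + 1 = ((N : ℤ) + 1) * (r + 1) := by
      obtain ⟨k, hk⟩ := hd
      have h5 : ((N : ℤ) + 1) * r < (N + 1) * k := by omega
      have h6 : (r : ℤ) < k := lt_of_mul_lt_mul_left h5 (by omega)
      have h7 : ((N : ℤ) + 1) * (r + 1) ≤ (N + 1) * k :=
        mul_le_mul_of_nonneg_left (by omega) (by omega)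
      omega
    rw [raceWord_of_mem h4 (by omega) hpos.2 (Finset.mem_image_of_mem _ hqb)]
    omega

theorem length_raceWord (hN : 1 ≤ N) (hM : M ∈ optRaces c 0 N) :
    (blockWord (raceWord c N M) (N * (N - 1))).length = N * (N - 1) + minCost c N := by
  rw [length_blockWord]
  congr 1
  have h1 := sum_raceWord (c := c) (M := M) fun r hr q hq => by
    have := optRaces_pos' hN hM hq r
    rw [min_eq_left hr.le] at this
    exact this
  rw [hM.2.2.2] at h1
  zify
  push_cast [hN] at h1
  linarith

/-- A block has length c + 1 exactly when the corresponding occupied position moves, so the word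
determines all moves. -/
theorem raceWord_injOn (c N : ℕ) :
    Set.InjOn (fun M => blockWord (raceWord c N M) (N * (N - 1))) (optRaces c 0 N) := by
  have key : ∀ M ∈ optRaces c 0 N, ∀ M' ∈ optRaces c 0 N,
      (∀ t < N * (N - 1), raceWord c N M t = raceWord c N M' t) → ∀ r, M r ⊆ M' r := by
    intro M hM M' hM' h r y hy
    obtain ⟨h1, h2, h3⟩ := optRaces_mem hM hy
    obtain ⟨t, ht⟩ : ∃ t : ℕ, y + t + 1 = ((N : ℤ) + 1) * (r + 1) := by
      have : (N : ℤ) + 1 ≤ (N + 1) * (r + 1) := le_mul_of_one_le_right (by omega) (by omega)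
      exact ⟨(((N : ℤ) + 1) * (r + 1) - y - 1).toNat, by omega⟩
    have h4 := h t (visit_lt ht h1 (by omega))
    rw [raceWord_of_mem ht (by omega) (by omega) (hM.1 r h1 hy), if_pos hy] at h4
    obtain ⟨e1, e2⟩ := visit_div ht (by omega) (by omega)
    rw [raceWord, e1, e2] at h4
    by_contra hcon
    rw [if_neg hcon] at h4
    split_ifs at h4
    omega
  intro M hM M' hM' h
  have h' := blockWord_inj h
  funext r
  exact Finset.Subset.antisymm (key M hM M' hM' h' r)
    (key M' hM' M hM (fun t ht => (h' t ht).symm) r)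

/-- In the race R pawns move exactly at blocks of length at least c + 1. Validity gives `raceWord c
N R t ≤ m t` for every block, while the totals satisfy the opposite inequality by `raceCost_ge`;
hence all blocks agree and R is tight. Restriction to occupied positions makes it a legal optimal
race without changing its word. -/
theorem exists_race_of_blocks (hc : 1 ≤ c) (hN : 1 ≤ N)
    (hv : ∀ q : ℕ, 1 ≤ q → q ≤ N → IsValidBlock c N m (N * (N - 1)) q)
    (hfin : ∀ q ∈ block 0 N, traj (blockMove c N m) (N * (N - 1)) q = N)
    (hsum : ∑ t ∈ Finset.range (N * (N - 1)), m t = minCost c N) :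
    ∃ M ∈ optRaces c 0 N, blockWord m (N * (N - 1)) =
      blockWord (raceWord c N M) (N * (N - 1)) := by
  set T := N * (N - 1) with hT
  have hTz : (T : ℤ) = N * (N - 1) := by rw [hT]; push_cast [hN]; ring
  -- the race given by the long blocks
  obtain ⟨R, hR⟩ : ∃ R : ℕ → Finset ℤ, ∀ r y, y ∈ R r ↔
      (1 ≤ y ∧ y ≤ (N : ℤ) + r) ∧ c + 1 ≤ m (((N : ℤ) + 1) * (r + 1) - y - 1).toNat :=
    ⟨fun r => (Finset.Icc 1 ((N : ℤ) + r)).filter fun y =>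
      c + 1 ≤ m (((N : ℤ) + 1) * (r + 1) - y - 1).toNat, fun r y => by simp⟩
  have hsys := isPawnSystem_race R
  have H : Follows c N R m T := by
    intro r t _ q hq h
    have h1 := hsys.traj_le_add q (Nat.zero_le r)
    have h2 := hsys.traj_le_traj q (Nat.zero_le r)
    simp only [traj] at h1 h2
    rw [Finset.mem_Icc] at hq
    rw [hR,
      show (((N : ℤ) + 1) * (r + 1) - traj (raceMove R) r q - 1).toNat = t by omega]
    exact ⟨fun h => ⟨by push_cast at h1; omega, h⟩, fun h => h.2⟩
  have hend : ∀ q ∈ block 0 N, traj (raceMove R) (N - 1) q = N := by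
    intro q hq
    -- At the end y + t = N + N(N-1) = N², which lies between (N + 1)(N - 1) and (N + 1)N, so the
    -- round is N - 1.
    obtain ⟨r, h1, h2, h3⟩ := H.exists_round hN hq le_rfl
    have h4 := hsys.traj_le_traj q (Nat.sub_le r 1)
    rw [hfin q hq] at h1
    rw [← h1, hTz] at h3 h2
    rw [← h1] at h4
    have h5 : ((N : ℤ) + 1) * (N - 1) < (N + 1) * (r + 1) := by linarith
    have h6 := lt_of_mul_lt_mul_left h5 (by omega)
    have h7 : ((N : ℤ) + 1) * r < (N + 1) * N := by linarith
    have h8 := lt_of_mul_lt_mul_left h7 (by omega)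
    rw [h1]
    congr 1
    omega
  have hpos : ∀ r ≤ N - 1, ∀ q ∈ block 0 N,
      (r : ℤ) + 1 ≤ traj (raceMove R) r q ∧ traj (raceMove R) r q ≤ N := by
    intro r hr q hq
    have h1 := hsys.traj_le_add q hr
    have h2 := hsys.traj_le_traj q hr
    rw [hend q hq] at h1 h2
    omega
  have hle : ∀ t ∈ Finset.range T, raceWord c N R t ≤ m t := by
    intro t ht
    rw [Finset.mem_range] at ht
    rw [raceWord]
    split_ifs with h1 h2
    all_goals try exact Nat.zero_le _
    all_goals
      obtain ⟨q, hq, hqy⟩ := Finset.mem_image.1 h1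
      have hd := div_visit (N := N) t
      have h3 := H.traj_eq_of_visit hN hq ht.le (by rw [hqy]; exact hd)
      have hq' := Finset.mem_Icc.1 hq
      have h4 := hv q.toNat (by omega) (by omega) t ht
      rw [Int.toNat_of_nonneg (by omega), h3, hqy] at h4
      have h5 := h4 ⟨_, hd⟩
    · rw [← hqy] at h2
      exact (H _ t ht q hq (by rw [hqy]; exact hd)).2 h2
    · exact h5
  have hcost := sum_raceWord (c := c) (M := R) fun r hr q hq => hpos r (by omega) q hq
  have hge := raceCost_ge hc hN (M := R) (s := 0) (t := N - 1) hend
  have hsum_le := Finset.sum_le_sum hle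
  have hcost' : groupCost c (raceMove R) raceVisits (block 0 N) (N - 1) = minCost c N := by
    rw [hsum] at hsum_le
    push_cast [hN] at hge
    have : (N : ℤ) - 1 - (N - 1) = 0 := by ring
    rw [this] at hge
    rw [← hT] at hcost
    omega
  have htight : IsTight c R 0 N (N - 1) (0 + N) := by
    refine ⟨fun q hq => by rw [hend q hq, zero_add], ?_⟩
    rw [hcost']
    push_cast [hN]
    ring
  refine ⟨_, htight.restrict_mem_optRaces, blockWord_congr fun t ht => ?_⟩
  have heq : raceWord c N R t = m t := by
    have h1 : ∑ t ∈ Finset.range T, raceWord c N R t = ∑ t ∈ Finset.range T, m t := by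
      rw [hsum]
      zify
      rw [← hcost', ← hcost]
      push_cast
      rfl
    exact (Finset.sum_eq_sum_iff_of_le hle).1 h1 t (Finset.mem_range.2 ht)
  rw [← heq]
  have hr : t / (N + 1) < N - 1 := by
    rw [Nat.div_lt_iff_lt_mul (by omega)]
    calc t < N * (N - 1) := ht
      _ ≤ (N - 1) * (N + 1) := by rw [mul_comm]; exact Nat.mul_le_mul_left _ (by omega)
  have hocc : (block 0 N).image
      (traj (raceMove (restrictMoves (block 0 N) R (N - 1))) (t / (N + 1))) =
      (block 0 N).image (traj (raceMove R) (t / (N + 1))) :=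
    Finset.image_congr fun q hq => traj_congr (traj_restrict hq) hr.le
  unfold raceWord
  rw [hocc]
  split_ifs with h1 h2 h3 h3
  · rfl
  · exact absurd (by rw [restrictMoves, if_pos hr]; exact Finset.mem_inter.2 ⟨h2, h1⟩) h3
  · rw [restrictMoves, if_pos hr] at h3
    exact absurd (Finset.mem_inter.1 h3).1 h2
  · rfl
  · rfl

/-- Words of optimal races attain both lower bounds at once, so a shortest word must attain both too
and comes from a race. Conversely these words all have the same length, and some shortest word is
among them. -/
theorem isShortest_iff (hc : 1 ≤ c) (hN : 1 ≤ N) (v : List Letter) :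
    (cernyPFA c (N + c + 1)).IsShortest {q | 1 ≤ q ∧ q ≤ N} v ↔
      v ∈ (fun M => blockWord (raceWord c N M) (N * (N - 1))) '' optRaces c 0 N := by
  have main : ∀ v, (cernyPFA c (N + c + 1)).IsShortest {q | 1 ≤ q ∧ q ≤ N} v →
      v ∈ (fun M => blockWord (raceWord c N M) (N * (N - 1))) '' optRaces c 0 N := by
    intro v hv
    obtain ⟨m, T, rfl, h⟩ := exists_blockWord_of_isShortest hN hv
    obtain ⟨h1, h2, h3⟩ := blockWord_lower_bound hc hN h
    obtain ⟨M, hM⟩ := (optRaces_finite_and_nonempty hc hN 0).2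
    have h4 := hv.2 _ (syncs_raceWord hN hM)
    rw [length_raceWord hN hM, length_blockWord] at h4
    obtain rfl : T = N * (N - 1) := by omega
    obtain ⟨M', hM', e⟩ := exists_race_of_blocks hc hN (fun q hq hq' => (h q hq hq').1) (h3 rfl)
      (by omega)
    exact ⟨M', hM', e.symm⟩
  refine ⟨main v, ?_⟩
  rintro ⟨M, hM, rfl⟩
  refine ⟨syncs_raceWord hN hM, fun u hu => ?_⟩
  obtain ⟨w, hw, hwmin⟩ : ∃ w, (cernyPFA c (N + c + 1)).IsShortest {q | 1 ≤ q ∧ q ≤ N} w ∧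
      w.length ≤ u.length := by
    have hex : ∃ l, ∃ w, (cernyPFA c (N + c + 1)).Syncs {q | 1 ≤ q ∧ q ≤ N} w ∧ w.length = l :=
      ⟨_, u, hu, rfl⟩
    classical
    obtain ⟨w, hw, hl⟩ := Nat.find_spec hex
    refine ⟨w, ⟨hw, fun x hx => ?_⟩, ?_⟩
    · rw [hl]
      exact Nat.find_min' hex ⟨x, hx, rfl⟩
    · rw [hl]
      exact Nat.find_min' hex ⟨u, hu, rfl⟩
  obtain ⟨M', hM', rfl⟩ := main w hw
  dsimp only at hwmin ⊢
  rw [length_raceWord hN hM'] at hwmin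
  rw [length_raceWord hN hM]
  exact hwmin

theorem existsUnique_isShortest_iff (hc : 1 ≤ c) (hN : 1 ≤ N) :
    (∃! v, (cernyPFA c (N + c + 1)).IsShortest {q | 1 ≤ q ∧ q ≤ N} v) ↔
      numOptimalRaces c N = 1 := by
  rw [numOptimalRaces_eq hc hN, ← (raceWord_injOn c N).ncard_image, Set.ncard_eq_one]
  simp only [isShortest_iff hc hN]
  constructor
  · rintro ⟨v, hv, huniq⟩
    exact ⟨v, Set.eq_singleton_iff_unique_mem.2 ⟨hv, huniq⟩⟩
  · rintro ⟨v, hv⟩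
    rw [hv]
    exact ⟨v, rfl, fun _ h => h⟩

end RaceWord

end WordOfRace

theorem mainTheorem4 (c : ℕ) (hc : 1 ≤ c) :
    (numOptimalRaces c 1 = 1 ∧ numOptimalRaces c 2 = 1) ∧
    (∀ n : ℕ, 3 ≤ n →
      numOptimalRaces c n =
        ∑ i ∈ indexSet c n, numOptimalRaces c (n - i) * numOptimalRaces c i) ∧
    (∀ n : ℕ, 1 ≤ n →
      (numOptimalRaces c n = 1 ↔ ∃ k' : ℕ, 1 ≤ k' ∧ n = pSeq c k') ∧
      ((∃ k' : ℕ, 1 ≤ k' ∧ n = pSeq c k') ↔ n = pSeq c (mSeq c n - 1))) ∧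
    (∀ n : ℕ, c + 2 ≤ n →
      ((∃! w : List Letter, (cernyPFA c n).IsShortestSynchronizing w) ↔
        ∃ k' : ℕ, 1 ≤ k' ∧ n - c - 1 = pSeq c k')) := by
  refine ⟨⟨numOptimalRaces_one hc, ?_⟩, fun n hn => numOptimalRaces_eq_sum hc (by omega),
    fun n hn => ⟨numOptimalRaces_eq_one_iff hc hn, exists_eq_pSeq_iff hc hn⟩, fun n hn => ?_⟩
  · rw [numOptimalRaces_eq_one_iff hc (by omega)]
    refine ⟨2 * c + 1, by omega, ?_⟩
    rw [pSeq_of_lt hc le_rfl, pSeq_of_le (by omega), pSeq_of_le (by omega)]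
  · obtain ⟨N, rfl⟩ : ∃ N, n = N + c + 1 := ⟨n - c - 1, by omega⟩
    rw [existsUnique_shortestSynchronizing_iff (by omega), existsUnique_isShortest_iff hc (by omega),
      numOptimalRaces_eq_one_iff hc (by omega), show N + c + 1 - c - 1 = N by omega]
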